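/- Let $d\ge 0$ and $m\ge 1$ be integers, let $H$ be a subgroup of $\mathrm{GL}(d)=\mathrm{GL}(\mathbb R^d)$, and let $G=H\ltimes\mathbb R^d$ act on the space $\mathfrak X(\mathbb R^d)=C^\infty(\mathbb R^d,\mathbb R^d)$ of smooth vector fields (a Fréchet space for uniform convergence on compact sets of all derivatives) by $((A,b)\cdot f)(x)=A f(A^{-1}(x-b))$. A map $\varphi\colon\mathfrak X(\mathbb R^d)\to\mathfrak X(\mathbb R^d)$ is called *local* if it does not increase supports, $\operatorname{supp}\varphi(f)\subset\operatorname{supp} f$, and $\varphi(f)(x)$ depends only on the germ of $f$ at $x$. A map of $m$ vector fields is called local if $\operatorname{supp}L(f_1,\dots,f_m)\subset\bigcup_i\operatorname{supp}f_i$ and $L(f_1,\dots,f_m)(x)$ depends only on the germs of $f_1,\dots,f_m$ at $x$. For a symmetric $m$-linear map $L$ put $\mathcal P(L)(f)=L(f,\dots,f)$. The *Taylor terms of order $m$* are the maps $\mathcal P(D^m\varphi(0))$, where $\varphi$ runs through the smooth, local, $G$-equivariant maps $\mathfrak X(\mathbb R^d)\to\mathfrak X(\mathbb R^d)$. Write $M=\mathbb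 R^d$. A *composition* is a finitely supported map $\kappa\colon\mathbb N\to\mathbb N$, with size $|\kappa|=\sum_j\kappa(j)$, and $$\mathrm{Sym}_\kappa = M\otimes\bigotimes_{j\ge 0}S^{\kappa(j)}(M^*\otimes S^jM)\cong\mathrm{Lin}\Bigl(\bigotimes_{j\ge 0} S^{\kappa(j)}(M\otimes S^jM^*),\,M\Bigr),$$ that is, the space of multilinear maps into $M$ that take, for every $j$, $\kappa(j)$ arguments in the space $M\otimes S^jM^*$ of symmetric $j$-linear maps $M^j\to M$ and are symmetric in these $\kappa(j)$ arguments. $\mathrm{Sym}_\kappa^H$ is its subspace of $H$-invariant elements for the tensor product action. Let $\mathrm{Lin}^{\mathrm{loc}}_G$ be the space of symmetric, continuous $m$-linear, local, $G$-equivariant maps $\mathfrak X(\mathbb R^d)^m\to\mathfrak X(\mathbb R^d)$. Then there is a linear bijection $$J\colon \mathrm{Lin}^{\mathrm{loc}}_G\to\bigoplus_{|\kappa|=m}\mathrm{Sym}_\kappa^H ,$$ the restriction to jets at the origin: for every $L$ there are $k\in\mathbb N$ and an $m$-linear map $\ell$ on the space $\bigoplus_{j\le k}M\otimes S^jM^*$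 of $k$-jets at $0$ with $L(f_1,\dots,f_m)(0)=\ell(j^k_0f_1,\dots,j^k_0f_m)$ for all $f_1,\dots,f_m$, and the component $J(L)_\kappa$ is $\ell$ evaluated on arguments of which exactly $\kappa(j)$ lie in $M\otimes S^jM^*$ for each $j$ (so it is zero if $\kappa(j)\ne0$ for some $j>k$). Moreover $\mathcal P\circ J^{-1}$ is a linear bijection from $\bigoplus_{|\kappa|=m}\mathrm{Sym}_\kappa^H$ onto the space of Taylor terms of order $m$ at the zero vector field of smooth, local, $G$-equivariant maps $\mathfrak X(\mathbb R^d)\to\mathfrak X(\mathbb R^d)$. -/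

import Mathlib

open scoped ContDiff Topology DirectSum
open Filter

noncomputable section

namespace AffineTaylor

/-- The affine space `ℝ^d`, also used as its own tangent space at the origin. -/
abbrev Pt (d : ℕ) : Type := EuclideanSpace ℝ (Fin d)

/-- Smooth vector fields on `ℝ^d`, as a linear subspace of all maps `ℝ^d → ℝ^d`. -/
def smoothFields (d : ℕ) : Submodule ℝ (Pt d → Pt d) where
  carrier := {f | ContDiff ℝ ∞ f}
  add_mem' {f g} hf hg := by
    have h1 : ContDiff ℝ ∞ f := hf
    have h2 : ContDiff ℝ ∞ g := hg
    exact h1.add h2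
  zero_mem' := by
    change ContDiff ℝ ∞ fun _ => 0
    exact contDiff_const
  smul_mem' c f hf := by
    have h1 : ContDiff ℝ ∞ f := hf
    exact h1.const_smul c

/-- The space of smooth vector fields on `ℝ^d`. It is a separate type so that it does not
inherit the topology of pointwise convergence. -/
def VF (d : ℕ) : Type := smoothFields d

variable {d : ℕ}

instance : AddCommGroup (VF d) := inferInstanceAs (AddCommGroup (smoothFields d))

instance : Module ℝ (VF d) := inferInstanceAs (Module ℝ (smoothFields d))

instance : CoeFun (VF d) (fun _ => Pt d → Pt d) := ⟨fun f => f.1⟩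

theorem VF.contDiff (f : VF d) : ContDiff ℝ ∞ (f : Pt d → Pt d) := f.2

theorem VF.coe_add (f g : VF d) : ((f + g : VF d) : Pt d → Pt d) = f + g := rfl

theorem VF.coe_smul (c : ℝ) (f : VF d) : ((c • f : VF d) : Pt d → Pt d) = c • (f : Pt d → Pt d) :=
  rfl

/-- The `k`-th derivative of a vector field, as a continuous map on `ℝ^d`. It depends linearly
on the vector field. -/
def VF.iterD (k : ℕ) : VF d →ₗ[ℝ] C(Pt d, Pt d [×k]→L[ℝ] Pt d) where
  toFun f := ⟨iteratedFDeriv ℝ k f,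
    f.contDiff.continuous_iteratedFDeriv (by exact_mod_cast le_top)⟩
  map_add' f g := by
    ext1 x
    exact iteratedFDeriv_add_apply (f.contDiff.of_le (by exact_mod_cast le_top)).contDiffAt
      (g.contDiff.of_le (by exact_mod_cast le_top)).contDiffAt
  map_smul' c f := by
    ext1 x
    exact iteratedFDeriv_const_smul_apply
      (f.contDiff.of_le (by exact_mod_cast le_top)).contDiffAt

/-- The Fréchet topology: uniform convergence on compact sets of all derivatives. -/
instance : TopologicalSpace (VF d) :=
  ⨅ k : ℕ, TopologicalSpace.induced (VF.iterD (d := d) k) inferInstance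

instance : IsTopologicalAddGroup (VF d) :=
  topologicalAddGroup_iInf fun k => topologicalAddGroup_induced (VF.iterD (d := d) k)

instance : ContinuousSMul ℝ (VF d) :=
  continuousSMul_iInf fun k => continuousSMul_induced (VF.iterD (d := d) k)

/-! ### Smooth maps between vector fields and their derivatives -/

/-- `D k σ (τ₁, …, τₖ)` is the `k`-th derivative of `φ` at `σ` in the directions `τ₁, …, τₖ`, and
all derivatives are jointly continuous: the usual notion of a smooth map between Fréchet spaces,
with `⟨Dψ(σ), τ⟩ = lim (ψ(σ + ετ) - ψ(σ)) / ε`. -/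
structure HasDerivatives (φ : VF d → VF d) (D : (k : ℕ) → VF d → (Fin k → VF d) → VF d) :
    Prop where
  zero : ∀ σ v, D 0 σ v = φ σ
  succ : ∀ k σ τ v, Tendsto (fun ε : ℝ => ε⁻¹ • (D k (σ + ε • τ) v - D k σ v)) (𝓝[≠] 0)
    (𝓝 (D (k + 1) σ (Fin.cons τ v)))
  continuous : ∀ k, Continuous fun p : VF d × (Fin k → VF d) => D k p.1 p.2

/-- `φ` is smooth and `T` is its `m`-th derivative at the zero vector field. -/
def IsSmoothWithTaylorTerm (m : ℕ) (φ : VF d → VF d) (T : (Fin m → VF d) → VF d) : Prop :=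
  ∃ D, HasDerivatives φ D ∧ T = D m 0

/-! ### Locality and equivariance -/

/-- A map on vector fields is local if it does not increase supports and the value at a point
only depends on the germ of the vector field at that point. -/
def IsLocal (φ : VF d → VF d) : Prop :=
  (∀ f : VF d, tsupport (φ f) ⊆ tsupport f) ∧
    ∀ (f g : VF d) (x : Pt d), (f : Pt d → Pt d) =ᶠ[𝓝 x] g → φ f x = φ g x

/-- Locality of a map of several vector fields, seen as a map on sections of the `m`-fold
direct sum of the tangent bundle. -/
def IsLocalMulti {m : ℕ} (L : (Fin m → VF d) → VF d) : Prop :=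
  (∀ f : Fin m → VF d, tsupport (L f) ⊆ ⋃ i, tsupport (f i)) ∧
    ∀ (f g : Fin m → VF d) (x : Pt d), (∀ i, (f i : Pt d → Pt d) =ᶠ[𝓝 x] g i) → L f x = L g x

/-- The action of the affine transformation `x ↦ A x + b` on vector fields. -/
def affAct (A : Pt d ≃L[ℝ] Pt d) (b : Pt d) (f : VF d) : VF d :=
  ⟨fun x => A (f (A.symm (x - b))),
    A.contDiff.comp (f.contDiff.comp (A.symm.contDiff.comp (contDiff_id.sub contDiff_const)))⟩

/-- Equivariance under `G = H ⋉ ℝ^d`. -/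
def IsEquivariant (H : Subgroup (Pt d ≃L[ℝ] Pt d)) (φ : VF d → VF d) : Prop :=
  ∀ A ∈ H, ∀ (b : Pt d) (f : VF d), φ (affAct A b f) = affAct A b (φ f)

/-- The homogeneous polynomial `f ↦ L(f, …, f)` of an `m`-linear map `L`. -/
def homPoly {m : ℕ} (L : (Fin m → VF d) → VF d) : VF d → VF d := fun f => L fun _ => f

/-- The Taylor terms of order `m` at the zero vector field of smooth, local, `G`-equivariant
maps. -/
def taylorTerms (H : Subgroup (Pt d ≃L[ℝ] Pt d)) (m : ℕ) : Set (VF d → VF d) :=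
  {p | ∃ φ T, IsLocal φ ∧ IsEquivariant H φ ∧ IsSmoothWithTaylorTerm m φ T ∧ p = homPoly T}

/-- The space of symmetric, (continuous) `m`-linear, local, `G`-equivariant maps on vector
fields. -/
def linLoc (H : Subgroup (Pt d ≃L[ℝ] Pt d)) (m : ℕ) :
    Submodule ℝ (ContinuousMultilinearMap ℝ (fun _ : Fin m => VF d) (VF d)) where
  carrier := {L | (∀ (σ : Equiv.Perm (Fin m)) (f : Fin m → VF d), L (fun i => f (σ i)) = L f) ∧
    IsLocalMulti L ∧
    ∀ A ∈ H, ∀ (b : Pt d) (f : Fin m → VF d), L (fun i => affAct A b (f i)) = affAct A b (L f)}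
  add_mem' := by
    rintro L L' ⟨h1, ⟨h2, h3⟩, h4⟩ ⟨h1', ⟨h2', h3'⟩, h4'⟩
    refine ⟨fun σ f => ?_, ⟨fun f => ?_, fun f g x h => ?_⟩, fun A hA b f => ?_⟩
    · simp only [add_apply, h1, h1']
    · rw [add_apply, VF.coe_add]
      exact (tsupport_add _ _).trans (Set.union_subset (h2 f) (h2' f))
    · simp only [add_apply, VF.coe_add, Pi.add_apply, h3 f g x h,
        h3' f g x h]
    · rw [add_apply, add_apply, h4 A hA,
        h4' A hA]
      exact Subtype.ext (funext fun x => (map_add A _ _).symm)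
  zero_mem' := by
    refine ⟨fun σ f => rfl, ⟨fun f => ?_, fun f g x h => rfl⟩, fun A hA b f => ?_⟩
    · have : (((0 : ContinuousMultilinearMap ℝ (fun _ : Fin m => VF d) (VF d)) f : VF d) :
        Pt d → Pt d) = 0 := rfl
      rw [this, tsupport_zero]
      exact Set.empty_subset _
    · exact Subtype.ext (funext fun x => (map_zero A).symm)
  smul_mem' := by
    rintro c L ⟨h1, ⟨h2, h3⟩, h4⟩
    refine ⟨fun σ f => ?_, ⟨fun f => ?_, fun f g x h => ?_⟩, fun A hA b f => ?_⟩
    · simp only [smul_apply, h1]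
    · rw [smul_apply, VF.coe_smul]
      exact (closure_mono (Function.support_const_smul_subset c _)).trans (h2 f)
    · simp only [smul_apply, VF.coe_smul, Pi.smul_apply, h3 f g x h]
    · rw [smul_apply, smul_apply, h4 A hA]
      exact Subtype.ext (funext fun x => (map_smul A c _).symm)

/-! ### Jets at the origin -/

/-- `ℝ^d ⊗ S^j (ℝ^d)^*`: the symmetric `j`-linear maps from `ℝ^d` to itself. -/
def symJet (d j : ℕ) : Submodule ℝ (Pt d [×j]→L[ℝ] Pt d) where
  carrier := {z | ∀ (σ : Equiv.Perm (Fin j)) (v : Fin j → Pt d), z (v ∘ σ) = z v}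
  add_mem' h h' σ v := by simp [h σ v, h' σ v]
  zero_mem' _ _ := rfl
  smul_mem' c _ h σ v := by simp [h σ v]

/-- The derivatives of a smooth map are symmetric. -/
theorem iteratedFDeriv_perm {f : Pt d → Pt d} (hf : ContDiff ℝ ∞ f) (n : ℕ) :
    ∀ (σ : Equiv.Perm (Fin n)) (x : Pt d) (v : Fin n → Pt d),
      iteratedFDeriv ℝ n f x (v ∘ σ) = iteratedFDeriv ℝ n f x v := by
  have hswap : ∀ n : ℕ, ∀ (i : Fin n) (x : Pt d) (v : Fin (n + 1) → Pt d),
      iteratedFDeriv ℝ (n + 1) f x (v ∘ Equiv.swap i.castSucc i.succ) =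
        iteratedFDeriv ℝ (n + 1) f x v := by
    intro n
    induction n with
    | zero => exact fun i => i.elim0
    | succ n ih =>
      intro i x v
      have hd : ∀ k : ℕ, ContDiff ℝ ∞ (iteratedFDeriv ℝ k f) := fun k =>
        hf.iteratedFDeriv_right (m := ∞) (by exact_mod_cast le_top)
      induction i using Fin.cases with
      | zero =>
        have key : ∀ w : Fin (n + 2) → Pt d, iteratedFDeriv ℝ (n + 2) f x w =
            fderiv ℝ (fderiv ℝ (iteratedFDeriv ℝ n f)) x (w 0) (w 1) (Fin.tail (Fin.tail w)) := by
          intro w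
          rw [iteratedFDeriv_succ_apply_left, iteratedFDeriv_succ_eq_comp_left]
          rw [LinearIsometryEquiv.comp_fderiv']
          rfl
        have hs : IsSymmSndFDerivAt ℝ (iteratedFDeriv ℝ n f) x :=
          (hd n).contDiffAt.isSymmSndFDerivAt (by
            simpa using (WithTop.coe_le_coe.2 (le_top : (2 : ℕ∞) ≤ ⊤)))
        rw [key, key]
        have h0 : (v ∘ Equiv.swap (Fin.castSucc (0 : Fin (n + 1))) (Fin.succ 0)) 0 = v 1 := by
          simp
        have h1 : (v ∘ Equiv.swap (Fin.castSucc (0 : Fin (n + 1))) (Fin.succ 0)) 1 = v 0 := by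
          simp
        have h2 : Fin.tail (Fin.tail (v ∘ Equiv.swap (Fin.castSucc (0 : Fin (n + 1)))
            (Fin.succ 0))) = Fin.tail (Fin.tail v) := by
          funext j
          simp only [Fin.tail, Function.comp_apply]
          rw [Equiv.swap_apply_of_ne_of_ne]
          · simp [Fin.ext_iff]
          · simp [Fin.ext_iff]
        rw [h0, h1, h2, hs.eq]
      | succ i =>
        have key : ∀ w : Fin (n + 2) → Pt d, iteratedFDeriv ℝ (n + 2) f x w =
            fderiv ℝ (fun y => iteratedFDeriv ℝ (n + 1) f y (Fin.tail w)) x (w 0) := by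
          intro w
          rw [iteratedFDeriv_succ_apply_left]
          rw [fderiv_continuousMultilinear_apply_const_apply]
          exact ((hd (n + 1)).differentiable (by simp)).differentiableAt
        rw [key, key]
        have h0 : (v ∘ Equiv.swap (Fin.castSucc i.succ) (Fin.succ i.succ)) 0 = v 0 := by
          simp only [Function.comp_apply]
          rw [Equiv.swap_apply_of_ne_of_ne] <;> simp [Fin.ext_iff]
        have h1 : Fin.tail (v ∘ Equiv.swap (Fin.castSucc i.succ) (Fin.succ i.succ)) =
            Fin.tail v ∘ Equiv.swap i.castSucc i.succ := by
          funext j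
          simp only [Fin.tail, Function.comp_apply, ← Fin.succ_castSucc]
          congr 1
          exact (Fin.succ_injective _).swap_apply _ _ _
        rw [h0, h1]
        simp only [ih]
  intro σ
  cases n with
  | zero => exact fun x v => congrArg _ (funext fun i => i.elim0)
  | succ n =>
    have hσ : σ ∈ Submonoid.closure
        (Set.range fun i : Fin n => Equiv.swap i.castSucc i.succ) := by
      rw [Equiv.Perm.mclosure_swap_castSucc_succ]
      trivial
    induction hσ using Submonoid.closure_induction with
    | mem _ h =>
      obtain ⟨i, rfl⟩ := h
      exact hswap n i
    | one => exact fun x v => rfl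
    | mul a b _ _ ha hb =>
      intro x v
      rw [Equiv.Perm.coe_mul, ← Function.comp_assoc, hb, ha]

/-- The degree-`j` part of the jet at the origin: the `j`-th derivative at `0`. -/
def jetPart (j : ℕ) (f : VF d) : symJet d j :=
  ⟨iteratedFDeriv ℝ j f 0, fun σ v => iteratedFDeriv_perm f.contDiff j σ 0 v⟩

/-- The space of `k`-jets of vector fields at the origin, `ℝ^d ⊗ ⨁_{j ≤ k} S^j (ℝ^d)^*`. -/
abbrev Jet (d k : ℕ) : Type := (j : Fin (k + 1)) → symJet d j

/-- The `k`-jet of a vector field at the origin. -/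
def jet (k : ℕ) (f : VF d) : Jet d k := fun j => jetPart j f

/-- The homogeneous part of degree `j`, put into the space of `k`-jets (zero if `j > k`). -/
def jetSingle (k j : ℕ) (z : symJet d j) : Jet d k :=
  if h : j < k + 1 then Pi.single (⟨j, h⟩ : Fin (k + 1)) z else 0

/-- The action of a linear map on `ℝ^d ⊗ S^j (ℝ^d)^*`:
`(A ⬝ z)(x₁, …, xⱼ) = A (z (A⁻¹ x₁, …, A⁻¹ xⱼ))`. -/
def jetAct (A : Pt d ≃L[ℝ] Pt d) (j : ℕ) (z : symJet d j) : symJet d j :=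
  ⟨(A : Pt d →L[ℝ] Pt d).compContinuousMultilinearMap
      (z.1.compContinuousLinearMap fun _ => (A.symm : Pt d →L[ℝ] Pt d)),
    fun σ v => congrArg A (z.2 σ fun i => A.symm (v i))⟩

/-! ### The spaces attached to compositions -/

/-- The space `Sym_κ` of a composition `κ`, that is
`ℝ^d ⊗ ⨂_j S^{κ(j)} ((ℝ^d)^* ⊗ S^j ℝ^d) = Lin (⨂_j S^{κ(j)} (ℝ^d ⊗ S^j (ℝ^d)^*), ℝ^d)`:
multilinear maps with values in `ℝ^d` that take, for every `j`, `κ(j)` arguments in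
`ℝ^d ⊗ S^j (ℝ^d)^*` and are symmetric in these `κ(j)` arguments. -/
def symSpace (d : ℕ) (κ : ℕ →₀ ℕ) :
    Submodule ℝ (MultilinearMap ℝ (fun p : (Σ j : ℕ, Fin (κ j)) => symJet d p.1) (Pt d)) where
  carrier := {s | ∀ (σ : ∀ j, Equiv.Perm (Fin (κ j)))
    (z : (p : Σ j : ℕ, Fin (κ j)) → symJet d p.1), s (fun p => z ⟨p.1, σ p.1 p.2⟩) = s z}
  add_mem' h h' σ z := by simp only [add_apply, h σ z, h' σ z]
  zero_mem' _ _ := rfl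
  smul_mem' c _ h σ z := by simp only [smul_apply, h σ z]

/-- The subspace `Sym_κ^H` of the elements of `Sym_κ` that are invariant under the action
`(A ⬝ s)(z) = A (s (A⁻¹ ⬝ z))` of `H`. -/
def symInv (κ : ℕ →₀ ℕ) (H : Subgroup (Pt d ≃L[ℝ] Pt d)) :
    Submodule ℝ (MultilinearMap ℝ (fun p : (Σ j : ℕ, Fin (κ j)) => symJet d p.1) (Pt d)) where
  carrier := {s | s ∈ symSpace d κ ∧
    ∀ A ∈ H, ∀ z, A (s fun p => jetAct A⁻¹ p.1 (z p)) = s z}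
  add_mem' h h' := ⟨add_mem h.1 h'.1, fun A hA z => by
    simp only [add_apply, map_add, h.2 A hA z, h'.2 A hA z]⟩
  zero_mem' := ⟨zero_mem _, fun A _ _ => map_zero A⟩
  smul_mem' c _ h := ⟨Submodule.smul_mem _ c h.1, fun A hA z => by
    simp only [smul_apply, map_smul, h.2 A hA z]⟩

/-- The direct sum of the spaces `Sym_κ^H` over all compositions `κ` of size `m`. -/
abbrev SymSum (H : Subgroup (Pt d ≃L[ℝ] Pt d)) (m : ℕ) : Type :=
  ⨁ κ : {κ : ℕ →₀ ℕ // κ.degree = m}, symInv κ.1 H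

/-- `s` is the restriction of `L` to jets at the origin: for some `k` the value of `L` at the
origin is an `m`-linear function `ℓ` of the `k`-jets at the origin, and the component `s_κ` is
`ℓ` evaluated on jets of which `κ(j)` are homogeneous of degree `j`, for every `j`. -/
def IsJetRestriction {H : Subgroup (Pt d ≃L[ℝ] Pt d)} {m : ℕ} (L : (Fin m → VF d) → VF d)
    (s : SymSum H m) : Prop :=
  ∃ (k : ℕ) (ℓ : MultilinearMap ℝ (fun _ : Fin m => Jet d k) (Pt d)),
    (∀ f : Fin m → VF d, L f 0 = ℓ fun i => jet k (f i)) ∧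
    ∀ (κ : {κ : ℕ →₀ ℕ // κ.degree = m}) (e : Fin m ≃ Σ j : ℕ, Fin (κ.1 j))
      (z : (p : Σ j : ℕ, Fin (κ.1 j)) → symJet d p.1),
      (s κ : MultilinearMap ℝ (fun p : (Σ j : ℕ, Fin (κ.1 j)) => symJet d p.1) (Pt d)) z =
        ℓ fun i => jetSingle k (e i).1 (z (e i))

end AffineTaylor

end

open AffineTaylor

noncomputable section

namespace AffineTaylor

open scoped ContDiff Topology DirectSum
open Filter

variable {d m : ℕ}

/-! ### Evaluation of vector fields and their derivatives -/

/-! The proof has an analytic half, that Taylor terms are exactly the polynomials `homPoly L` with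
`L` in `linLoc H m`, and an algebraic half, that such `L` are the same as finite families of
invariant multilinear maps on jets at the origin.

Taylor terms. The derivatives of a smooth map are multilinear, and they inherit locality and
equivariance because these pass to limits of difference quotients. Symmetrizing does not change the
polynomial, so every Taylor term comes from `linLoc`. Conversely `homPoly L / m!` is itself a
smooth, local, equivariant map whose `m`-th derivative at zero is `L`. Uniqueness of derivatives
then gives polarization: `L` is determined by `homPoly L` (`eq_of_homPoly_eq`).

Jets. The key point is a Peetre-type statement for multilinear maps, `exists_order`: continuity
bounds `L` at the origin by finitely many derivatives, and a field with vanishing `k`-jet has the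
same germ as fields that are arbitrarily small in those derivatives. Hence `L f 0` depends only on
`k`-jets. Translations carry the origin to any other point, so `L` is determined by its values at
the origin on homogeneous polynomial fields, sorted by their degrees, that is, by compositions. The
order `k` leaves only finitely many nonzero components, hence a direct sum and not a product.

In the other direction an invariant `t` in `Sym_κ` defines the differential operator `jetOp`, which
is symmetrized over its arguments. On homogeneous fields only permutations compatible with the
degrees contribute, so after normalization the component at `κ` is `t` and all others vanish
(`sumOp_homField_compEquiv`). Thus `sumOp` is the inverse of the restriction to jets. -/

theorem VF.ext {f g : VF d} (h : ∀ x, f x = g x) : f = g := Subtype.ext (funext h)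

theorem VF.zero_apply (x : Pt d) : (0 : VF d) x = 0 := rfl

theorem VF.add_apply (f g : VF d) (x : Pt d) : (f + g) x = f x + g x := rfl

theorem VF.sub_apply (f g : VF d) (x : Pt d) : (f - g) x = f x - g x := rfl

theorem VF.smul_apply (c : ℝ) (f : VF d) (x : Pt d) : (c • f) x = c • f x := rfl

theorem VF.continuous_iterD (k : ℕ) : Continuous (VF.iterD (d := d) k) :=
  continuous_iInf_dom (i := k) continuous_induced_dom

theorem VF.continuous_iteratedFDeriv {X : Type*} [TopologicalSpace X] (k : ℕ) {f : X → VF d}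
    {x : X → Pt d} (hf : Continuous f) (hx : Continuous x) :
    Continuous fun p => iteratedFDeriv ℝ k (f p) (x p) :=
  ((VF.continuous_iterD k).comp hf).eval hx

/-- Evaluation of vector fields at a point. -/
def VF.eval (x : Pt d) : VF d →L[ℝ] Pt d where
  toFun f := f x
  map_add' _ _ := rfl
  map_smul' _ _ := rfl
  cont := by
    have h := VF.continuous_iteratedFDeriv (d := d) 0 continuous_id
      (continuous_const (y := x))
    have h2 := ((ContinuousMultilinearMap.apply ℝ (fun _ : Fin 0 => Pt d) (Pt d) 0).continuous).comp h
    exact h2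

theorem VF.eval_apply (x : Pt d) (f : VF d) : VF.eval x f = f x := rfl

theorem VF.sum_apply {ι : Type*} (s : Finset ι) (f : ι → VF d) (x : Pt d) :
    (∑ i ∈ s, f i) x = ∑ i ∈ s, f i x :=
  map_sum (VF.eval x) f s

/-- A map into vector fields is continuous if all its derivatives are jointly continuous. -/
theorem VF.continuous_of_iteratedFDeriv {X : Type*} [TopologicalSpace X] {F : X → VF d}
    (h : ∀ k, Continuous fun p : X × Pt d => iteratedFDeriv ℝ k (F p.1) p.2) : Continuous F :=
  continuous_iInf_rng.2 fun k => continuous_induced_rng.2 <|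
    ContinuousMap.continuous_of_continuous_uncurry _ (h k)

/-! ### Derivatives of smooth maps between vector fields -/

section HasDerivatives

variable {φ : VF d → VF d} {D : (k : ℕ) → VF d → (Fin k → VF d) → VF d}

theorem HasDerivatives.hasDerivAt (h : HasDerivatives φ D) (k : ℕ) (σ τ : VF d)
    (v : Fin k → VF d) (x : Pt d) (r : ℝ) :
    HasDerivAt (fun r : ℝ => D k (σ + r • τ) v x) (D (k + 1) (σ + r • τ) (Fin.cons τ v) x) r := by
  rw [hasDerivAt_iff_tendsto_slope_zero]
  have := ((VF.eval x).continuous.tendsto _).comp (h.succ k (σ + r • τ) τ v)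
  refine this.congr fun ε => ?_
  simp only [Function.comp_apply, VF.eval_apply, VF.smul_apply, VF.sub_apply, add_smul, add_assoc]

/-- `HasDerivatives` asks only for directional derivatives that are jointly continuous. Linearity in
the direction is a consequence: the function of `(r, s)` along `σ + r • τ + s • τ'` has continuous
partial derivatives, hence is differentiable, and is then restricted to the diagonal. -/
theorem HasDerivatives.cons_add (h : HasDerivatives φ D) (k : ℕ) (σ τ τ' : VF d)
    (v : Fin k → VF d) :
    D (k + 1) σ (Fin.cons (τ + τ') v) =
      D (k + 1) σ (Fin.cons τ v) + D (k + 1) σ (Fin.cons τ' v) := by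
  refine VF.ext fun x => ?_
  have hc : ∀ ρ : VF d, Continuous fun p : ℝ × ℝ =>
      (1 : ℝ →L[ℝ] ℝ).smulRight (D (k + 1) (σ + p.1 • τ + p.2 • τ') (Fin.cons ρ v) x) := by
    intro ρ
    have h1 : Continuous fun p : ℝ × ℝ =>
        ((σ + p.1 • τ + p.2 • τ', Fin.cons ρ v) : VF d × (Fin (k + 1) → VF d)) := by
      fun_prop
    exact (ContinuousLinearMap.smulRightL ℝ ℝ (Pt d) 1).continuous.comp
      ((VF.eval x).continuous.comp ((h.continuous (k + 1)).comp h1))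
  have key := hasStrictFDerivAt_uncurry_coprod (𝕜 := ℝ) (u := ((0 : ℝ), (0 : ℝ)))
    (f := fun r s => D k (σ + r • τ + s • τ') v x)
    (f₁ := fun r s => (1 : ℝ →L[ℝ] ℝ).smulRight
      (D (k + 1) (σ + r • τ + s • τ') (Fin.cons τ v) x))
    (f₂ := fun r s => (1 : ℝ →L[ℝ] ℝ).smulRight
      (D (k + 1) (σ + r • τ + s • τ') (Fin.cons τ' v) x))
    (Eventually.of_forall fun p => by
      have := (h.hasDerivAt k (σ + p.2 • τ') τ v x p.1).hasFDerivAt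
      simpa only [add_right_comm σ _ (_ • τ')] using! this)
    (Eventually.of_forall fun p => (h.hasDerivAt k (σ + p.1 • τ) τ' v x p.2).hasFDerivAt)
    (hc τ).continuousAt (hc τ').continuousAt
  have hdiag : HasDerivAt (fun r : ℝ => (r, r)) ((1 : ℝ), (1 : ℝ)) 0 :=
    (hasDerivAt_id 0).prodMk (hasDerivAt_id 0)
  have h1 := key.hasFDerivAt.comp_hasDerivAt (f := fun r : ℝ => (r, r)) (0 : ℝ) hdiag
  have h2 := h.hasDerivAt k σ (τ + τ') v x 0
  have h3 := h2.unique (by simpa only [smul_add, ← add_assoc] using! h1)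
  simpa [Function.HasUncurry.uncurry] using! h3

theorem HasDerivatives.cons_smul (h : HasDerivatives φ D) (k : ℕ) (σ τ : VF d) (c : ℝ)
    (v : Fin k → VF d) :
    D (k + 1) σ (Fin.cons (c • τ) v) = c • D (k + 1) σ (Fin.cons τ v) := by
  refine VF.ext fun x => ?_
  have h1 := h.hasDerivAt k σ (c • τ) v x 0
  have h2 := h.hasDerivAt k σ τ v x (0 * c)
  have h3 := HasDerivAt.scomp (0 : ℝ) h2 ((hasDerivAt_id (0 : ℝ)).mul_const c)
  have h4 := h1.unique (by simpa only [Function.comp_def, id, mul_smul] using! h3)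
  simpa using! h4

/-- A relation between values at points that holds for the difference quotients passes to the
derivative. -/
theorem HasDerivatives.eval_succ_congr {φ' : VF d → VF d}
    {D' : (k : ℕ) → VF d → (Fin k → VF d) → VF d} (h : HasDerivatives φ D)
    (h' : HasDerivatives φ' D') {k : ℕ} {σ σ' τ τ' : VF d} {v v' : Fin k → VF d} {x x' : Pt d}
    {A : Pt d →L[ℝ] Pt d}
    (H : ∀ ε : ℝ, D k (σ + ε • τ) v x = A (D' k (σ' + ε • τ') v' x')) :
    D (k + 1) σ (Fin.cons τ v) x = A (D' (k + 1) σ' (Fin.cons τ' v') x') := by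
  have h1 := h.hasDerivAt k σ τ v x 0
  have h2 := A.hasFDerivAt.comp_hasDerivAt (0 : ℝ) (h'.hasDerivAt k σ' τ' v' x' 0)
  have h3 := h1.unique (by simpa only [Function.comp_def, ← H] using! h2)
  simpa using! h3

/-- Each `D (k + 1)` is a limit of difference quotients of `D k`, and limits are unique pointwise.
-/
theorem HasDerivatives.unique {D' : (k : ℕ) → VF d → (Fin k → VF d) → VF d}
    (h : HasDerivatives φ D) (h' : HasDerivatives φ D') : D = D' := by
  funext k
  induction k with
  | zero => funext σ v; rw [h.zero, h'.zero]
  | succ k ih =>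
    funext σ v
    refine VF.ext fun x => ?_
    rw [← Fin.cons_self_tail v]
    exact h.eval_succ_congr h' (A := .id ℝ _) fun ε => by rw [ih]; rfl

/-- The newest direction is handled by `cons_add`. For an older one, the additivity already known
for `D k` at every base point is differentiated in the newest direction. -/
theorem HasDerivatives.map_update_add (h : HasDerivatives φ D) (k : ℕ) :
    ∀ (σ : VF d) (v : Fin k → VF d) (i : Fin k) (a b : VF d),
      D k σ (Function.update v i (a + b)) =
        D k σ (Function.update v i a) + D k σ (Function.update v i b) := by
  induction k with
  | zero => exact fun _ _ i => i.elim0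
  | succ k ih =>
    intro σ v i a b
    induction v using Fin.consCases with | _ τ v
    induction i using Fin.cases with
    | zero => simp only [Fin.update_cons_zero, h.cons_add]
    | succ i =>
      simp only [← Fin.cons_update]
      refine VF.ext fun x => ?_
      have h1 := h.hasDerivAt k σ τ (Function.update v i (a + b)) x 0
      have h2 := (h.hasDerivAt k σ τ (Function.update v i a) x 0).add
        (h.hasDerivAt k σ τ (Function.update v i b) x 0)
      have h3 := h1.unique (by simpa only [ih, VF.add_apply] using! h2)
      simpa using! h3

theorem HasDerivatives.map_update_smul (h : HasDerivatives φ D) (k : ℕ) :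
    ∀ (σ : VF d) (v : Fin k → VF d) (i : Fin k) (c : ℝ) (a : VF d),
      D k σ (Function.update v i (c • a)) = c • D k σ (Function.update v i a) := by
  induction k with
  | zero => exact fun _ _ i => i.elim0
  | succ k ih =>
    intro σ v i c a
    induction v using Fin.consCases with | _ τ v
    induction i using Fin.cases with
    | zero => simp only [Fin.update_cons_zero, h.cons_smul]
    | succ i =>
      simp only [← Fin.cons_update]
      refine VF.ext fun x => ?_
      exact h.eval_succ_congr h (A := c • .id ℝ _) (v := Function.update v i (c • a))
        (v' := Function.update v i a) (x' := x) fun ε => by rw [ih]; rfl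

/-- The `m`-th derivative as a continuous multilinear map. -/
def HasDerivatives.toMultilinear (h : HasDerivatives φ D) (m : ℕ) (σ : VF d) :
    ContinuousMultilinearMap ℝ (fun _ : Fin m => VF d) (VF d) where
  toMultilinearMap := MultilinearMap.mk' (D m σ) (fun v i a b => h.map_update_add m σ v i a b)
    fun v i c a => h.map_update_smul m σ v i c a
  cont := (h.continuous m).comp (Continuous.prodMk_right σ)

/-- If base points and directions have equal germs at `x`, so do all points `σ + ε • τ`; the
difference quotients at `x` therefore agree. -/
theorem HasDerivatives.congr_of_germ (h : HasDerivatives φ D) (hφ : IsLocal φ) {x : Pt d} (k : ℕ) :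
    ∀ {σ σ' : VF d} {v v' : Fin k → VF d}, (σ : Pt d → Pt d) =ᶠ[𝓝 x] σ' →
      (∀ i, (v i : Pt d → Pt d) =ᶠ[𝓝 x] v' i) → D k σ v x = D k σ' v' x := by
  induction k with
  | zero => intro σ σ' v v' hσ _; rw [h.zero, h.zero]; exact hφ.2 _ _ _ hσ
  | succ k ih =>
    intro σ σ' v v' hσ hv
    rw [← Fin.cons_self_tail v, ← Fin.cons_self_tail v']
    refine h.eval_succ_congr h (A := .id ℝ _) fun ε => ih ?_ fun i => hv i.succ
    filter_upwards [hσ, hv 0] with y h1 h2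
    rw [VF.add_apply, VF.add_apply, VF.smul_apply, VF.smul_apply, h1, h2]

theorem affAct_add_smul (A : Pt d ≃L[ℝ] Pt d) (b : Pt d) (f g : VF d) (c : ℝ) :
    affAct A b (f + c • g) = affAct A b f + c • affAct A b g :=
  VF.ext fun x => by
    change A (f _ + c • g _) = A (f _) + c • A (g _)
    rw [map_add, map_smul]

theorem HasDerivatives.equivariant (h : HasDerivatives φ D) {A : Pt d ≃L[ℝ] Pt d} {b : Pt d}
    (hφ : ∀ f, φ (affAct A b f) = affAct A b (φ f)) (k : ℕ) :
    ∀ (σ : VF d) (v : Fin k → VF d),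
      D k (affAct A b σ) (fun i => affAct A b (v i)) = affAct A b (D k σ v) := by
  induction k with
  | zero => intro σ v; rw [h.zero, h.zero, hφ]
  | succ k ih =>
    intro σ v
    refine VF.ext fun x => ?_
    rw [← Fin.cons_self_tail v, ← Fin.cons_self_tail fun i => affAct A b _]
    refine h.eval_succ_congr h (A := (A : Pt d →L[ℝ] Pt d)) (x' := A.symm (x - b)) fun ε => ?_
    change D k (_ + ε • affAct A b (v 0)) (fun i => affAct A b (Fin.tail v i)) x = _
    rw [← affAct_add_smul, ih]
    rfl

end HasDerivatives

/-! ### Derivatives of homogeneous polynomials -/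

/-- The directional derivative of a continuous multilinear map on a topological vector space. -/
theorem tendsto_slope_multilinear {E F : Type*} [AddCommGroup E] [Module ℝ E] [TopologicalSpace E]
    [AddCommGroup F] [Module ℝ F] [TopologicalSpace F] [IsTopologicalAddGroup F]
    [ContinuousSMul ℝ F] (L : ContinuousMultilinearMap ℝ (fun _ : Fin m => E) F)
    (w u : Fin m → E) :
    Tendsto (fun ε : ℝ => ε⁻¹ • (L (w + ε • u) - L w)) (𝓝[≠] 0)
      (𝓝 (∑ i, L (Function.update w i (u i)))) := by
  -- Expanding `L (w + ε • u)` over the set `s` of slots filled from `ε • u`, the term of `s`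
  -- carries the factor `ε ^ s.card`.
  have hs : ∀ (ε : ℝ) (s : Finset (Fin m)),
      L (s.piecewise (ε • u) w) = ε ^ s.card • L (s.piecewise u w) := by
    intro ε s
    have h1 : s.piecewise (ε • u) w =
        s.piecewise (fun i => ε • s.piecewise u w i) (s.piecewise u w) := by
      funext i
      by_cases hi : i ∈ s <;> simp [hi]
    rw [h1, L.map_piecewise_smul (fun _ => ε), Finset.prod_const]
  have hq : ∀ ε : ℝ, ε ≠ 0 → ∑ s ∈ Finset.univ.erase (∅ : Finset (Fin m)),
      ε ^ (s.card - 1) • L (s.piecewise u w) = ε⁻¹ • (L (w + ε • u) - L w) := by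
    intro ε hε
    rw [add_comm w, L.map_add_univ, ← Finset.add_sum_erase _ _ (Finset.mem_univ ∅),
      Finset.piecewise_empty, add_sub_cancel_left, Finset.smul_sum]
    refine Finset.sum_congr rfl fun s hs' => ?_
    rw [hs, smul_smul]
    have hc : s.card ≠ 0 := by simpa using hs'
    obtain ⟨n, hn⟩ := Nat.exists_eq_succ_of_ne_zero hc
    rw [hn, Nat.succ_sub_one, pow_succ, mul_comm, mul_assoc, mul_inv_cancel₀ hε, mul_one]
  have hlim : Tendsto (fun ε : ℝ => ∑ s ∈ Finset.univ.erase (∅ : Finset (Fin m)),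
      ε ^ (s.card - 1) • L (s.piecewise u w)) (𝓝[≠] 0)
      (𝓝 (∑ s ∈ Finset.univ.erase (∅ : Finset (Fin m)),
        (0 : ℝ) ^ (s.card - 1) • L (s.piecewise u w))) := by
    refine Tendsto.mono_left (Continuous.tendsto ?_ 0) nhdsWithin_le_nhds
    fun_prop
  -- Since `0 ^ 0 = 1`, the limit keeps exactly the singletons.
  have h0 : ∑ s ∈ Finset.univ.erase (∅ : Finset (Fin m)),
      (0 : ℝ) ^ (s.card - 1) • L (s.piecewise u w) = ∑ i, L (Function.update w i (u i)) := by
    rw [← Finset.sum_subset (s₁ := Finset.powersetCard 1 (Finset.univ : Finset (Fin m)))]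
    · rw [Finset.powersetCard_one, Finset.sum_map]
      refine Finset.sum_congr rfl fun i _ => ?_
      simp [Finset.piecewise_singleton]
    · intro s hs'
      have : s.card = 1 := (Finset.mem_powersetCard.1 hs').2
      simp only [Finset.mem_erase, Finset.mem_univ, and_true]
      rintro rfl
      simp at this
    · intro s h1 h2
      have hc : s.card ≠ 0 := by simpa using h1
      have hc' : s.card ≠ 1 := by simpa [Finset.mem_powersetCard] using h2
      rw [zero_pow (by omega), zero_smul]
  rw [← h0]
  refine hlim.congr' ?_
  filter_upwards [self_mem_nhdsWithin] with ε hε using hq ε hε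

/-- The arguments `vₖ₋₁, …, v₀, σ, …, σ` of an `m`-linear map. -/
def fillDirs (m k : ℕ) (σ : VF d) (v : Fin k → VF d) : Fin m → VF d :=
  fun i => if h : (i : ℕ) < k then v (Fin.rev ⟨i, h⟩) else σ

/-- `Fin.cons` puts the newest direction at index `0`; the reversal in `fillDirs` sends it to the
first free slot `k` and leaves the older directions in place. -/
theorem fillDirs_cons {k : ℕ} (hk : k < m) (σ τ : VF d) (v : Fin k → VF d) :
    fillDirs m (k + 1) σ (Fin.cons τ v) = Function.update (fillDirs m k σ v) ⟨k, hk⟩ τ := by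
  funext i
  rcases lt_trichotomy (i : ℕ) k with h | h | h
  · have hi : i ≠ ⟨k, hk⟩ := fun e => h.ne (congrArg Fin.val e)
    have hr : Fin.rev (⟨i, h.trans k.lt_succ_self⟩ : Fin (k + 1)) =
        Fin.succ (Fin.rev ⟨i, h⟩) := by
      ext
      simp [Fin.val_rev]
      omega
    simp only [fillDirs, Function.update_of_ne hi, h, h.trans k.lt_succ_self, dif_pos, hr,
      Fin.cons_succ]
  · have hi : i = ⟨k, hk⟩ := Fin.ext h
    subst hi
    have hr : Fin.rev (⟨k, k.lt_succ_self⟩ : Fin (k + 1)) = 0 := by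
      ext
      simp [Fin.val_rev]
    simp [fillDirs, hr]
  · have hi : i ≠ ⟨k, hk⟩ := fun e => h.ne' (congrArg Fin.val e)
    have h1 : ¬ (i : ℕ) < k := by omega
    have h2 : ¬ (i : ℕ) < k + 1 := by omega
    simp only [fillDirs, Function.update_of_ne hi, h1, h2, dif_neg, not_false_eq_true]

theorem continuous_fillDirs (m k : ℕ) :
    Continuous fun p : VF d × (Fin k → VF d) => fillDirs m k p.1 p.2 := by
  refine continuous_pi fun i => ?_
  by_cases h : (i : ℕ) < k
  · simp only [fillDirs, h, dif_pos]
    fun_prop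
  · simp only [fillDirs, h, dif_neg, not_false_eq_true]
    fun_prop

/-- For symmetric `L`, the normalized polynomial `f ↦ L(f, …, f) / m!` is smooth, with explicit
derivatives. -/
theorem hasDerivatives_homPoly (L : ContinuousMultilinearMap ℝ (fun _ : Fin m => VF d) (VF d))
    (hL : ∀ (σ : Equiv.Perm (Fin m)) (f : Fin m → VF d), L (fun i => f (σ i)) = L f) :
    HasDerivatives (fun f => (m.factorial : ℝ)⁻¹ • homPoly L f)
      fun k σ v => ((m.factorial : ℝ)⁻¹ * m.descFactorial k) • L (fillDirs m k σ v) where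
  zero σ v := by
    rw [Nat.descFactorial_zero, Nat.cast_one, mul_one]
    rfl
  continuous k := (L.cont.comp (continuous_fillDirs m k)).fun_const_smul _
  succ k σ τ v := by
    -- Moving the base point by `τ` changes only the slots not yet occupied by directions.
    set u : Fin m → VF d := fun i => if (i : ℕ) < k then 0 else τ with hu
    have hw : ∀ ε : ℝ, fillDirs m k (σ + ε • τ) v = fillDirs m k σ v + ε • u := by
      intro ε
      funext i
      by_cases h : (i : ℕ) < k <;> simp [fillDirs, hu, h]
    -- By symmetry all free slots contribute equally. For `k ≥ m` there is none: the truncated `m -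
    -- k` is `0`, and so is `m.descFactorial (k + 1)`.
    have hsum : ∑ i, L (Function.update (fillDirs m k σ v) i (u i)) =
        ((m - k : ℕ) : ℝ) • L (fillDirs m (k + 1) σ (Fin.cons τ v)) := by
      have hterm : ∀ i : Fin m, L (Function.update (fillDirs m k σ v) i (u i)) =
          if (i : ℕ) < k then 0 else L (fillDirs m (k + 1) σ (Fin.cons τ v)) := by
        intro i
        by_cases h : (i : ℕ) < k
        · simp only [hu, h, if_true]
          exact L.map_coord_zero i (Function.update_self _ _ _)
        · simp only [hu, h, if_false]
          have hk : k < m := by omega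
          rw [fillDirs_cons hk, ← hL (Equiv.swap i ⟨k, hk⟩)]
          congr 1
          funext j
          have hik : fillDirs m k σ v i = σ := by simp [fillDirs, h]
          have hkk : fillDirs m k σ v ⟨k, hk⟩ = σ := by simp [fillDirs]
          rcases eq_or_ne j ⟨k, hk⟩ with rfl | hjk
          · rw [Equiv.swap_apply_right, Function.update_self, Function.update_self]
          · rw [Function.update_of_ne hjk]
            rcases eq_or_ne j i with rfl | hji
            · rw [Equiv.swap_apply_left, Function.update_of_ne hjk.symm, hik, hkk]
            · rw [Equiv.swap_apply_of_ne_of_ne hji hjk, Function.update_of_ne hji]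
      rw [Finset.sum_congr rfl fun i _ => hterm i, Finset.sum_ite, Finset.sum_const_zero, zero_add,
        Finset.sum_const, ← Nat.cast_smul_eq_nsmul ℝ]
      congr 2
      have h1 := Finset.card_filter_add_card_filter_not (s := (Finset.univ : Finset (Fin m)))
        (fun i : Fin m => (i : ℕ) < k)
      rw [Fin.card_filter_val_lt, Finset.card_univ, Fintype.card_fin] at h1
      omega
    have h := (tendsto_slope_multilinear L (fillDirs m k σ v) u).const_smul
      ((m.factorial : ℝ)⁻¹ * m.descFactorial k)
    rw [hsum, smul_smul] at h
    convert! h using 2 with ε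
    · rw [hw, smul_comm, ← smul_sub]
    · rw [Nat.descFactorial_succ]
      push_cast
      ring_nf

/-- The left side is the `m`-th derivative at zero of `homPoly L / m!`: the coefficient is `m! /
m!`, and symmetry undoes the reversal of the arguments. -/
theorem taylorTerm_homPoly (L : ContinuousMultilinearMap ℝ (fun _ : Fin m => VF d) (VF d))
    (hL : ∀ (σ : Equiv.Perm (Fin m)) (f : Fin m → VF d), L (fun i => f (σ i)) = L f)
    (v : Fin m → VF d) :
    ((m.factorial : ℝ)⁻¹ * m.descFactorial m) • L (fillDirs m m 0 v) = L v := by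
  rw [Nat.descFactorial_self, inv_mul_cancel₀ (by exact_mod_cast m.factorial_ne_zero), one_smul,
    ← hL Fin.revPerm v]
  congr 1
  funext i
  simp [fillDirs]

/-- A symmetric continuous multilinear map is determined by its homogeneous polynomial. -/
theorem eq_of_homPoly_eq {L L' : ContinuousMultilinearMap ℝ (fun _ : Fin m => VF d) (VF d)}
    (hL : ∀ (σ : Equiv.Perm (Fin m)) (f : Fin m → VF d), L (fun i => f (σ i)) = L f)
    (hL' : ∀ (σ : Equiv.Perm (Fin m)) (f : Fin m → VF d), L' (fun i => f (σ i)) = L' f)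
    (h : homPoly L = homPoly L') : L = L' := by
  -- Polarization through uniqueness of derivatives: equal polynomials have equal `m`-th derivatives
  -- at zero.
  have h1 := hasDerivatives_homPoly L hL
  rw [h] at h1
  have h2 := h1.unique (hasDerivatives_homPoly L' hL')
  ext1 v
  rw [← taylorTerm_homPoly L hL, ← taylorTerm_homPoly L' hL']
  exact congrFun (congrFun (congrFun h2 m) 0) v

/-! ### Symmetrization -/

/-- For multilinear maps of at least one vector field, dependence on germs implies the condition
on supports. -/
theorem isLocalMulti_of_germ (hm : 1 ≤ m)
    (L : ContinuousMultilinearMap ℝ (fun _ : Fin m => VF d) (VF d))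
    (h : ∀ (f g : Fin m → VF d) (x : Pt d), (∀ i, (f i : Pt d → Pt d) =ᶠ[𝓝 x] g i) →
      L f x = L g x) : IsLocalMulti L := by
  refine ⟨fun f => closure_minimal (fun x hx => ?_)
    (isClosed_iUnion_of_finite fun i => isClosed_tsupport _), h⟩
  by_contra hx'
  simp only [Set.mem_iUnion, not_exists] at hx'
  refine hx ?_
  rw [h f (fun _ => 0) x fun i => notMem_tsupport_iff_eventuallyEq.1 (hx' i)]
  have : L (fun _ => 0) = 0 := L.map_coord_zero (⟨0, hm⟩ : Fin m) rfl
  rw [this]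
  rfl

/-- The sum of a multilinear map over all permutations of its arguments. -/
def symmetrize (L : ContinuousMultilinearMap ℝ (fun _ : Fin m => VF d) (VF d)) :
    ContinuousMultilinearMap ℝ (fun _ : Fin m => VF d) (VF d) :=
  ∑ σ : Equiv.Perm (Fin m), L.domDomCongr σ

theorem symmetrize_apply (L : ContinuousMultilinearMap ℝ (fun _ : Fin m => VF d) (VF d))
    (f : Fin m → VF d) :
    symmetrize L f = ∑ σ : Equiv.Perm (Fin m), L fun i => f (σ i) := by
  simp [symmetrize]

theorem homPoly_symmetrize (L : ContinuousMultilinearMap ℝ (fun _ : Fin m => VF d) (VF d)) :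
    homPoly (symmetrize L) = (m.factorial : ℝ) • homPoly L := by
  funext f
  simp only [homPoly, symmetrize_apply, Pi.smul_apply, Finset.sum_const, Finset.card_univ,
    Fintype.card_perm, Fintype.card_fin, Nat.cast_smul_eq_nsmul]

theorem affAct_sum {ι : Type*} (s : Finset ι) (A : Pt d ≃L[ℝ] Pt d) (b : Pt d) (f : ι → VF d) :
    affAct A b (∑ i ∈ s, f i) = ∑ i ∈ s, affAct A b (f i) :=
  VF.ext fun x => by
    rw [VF.sum_apply]
    change A ((∑ i ∈ s, f i) _) = _
    rw [VF.sum_apply, map_sum]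
    rfl

theorem symmetrize_mem_linLoc (hm : 1 ≤ m) {H : Subgroup (Pt d ≃L[ℝ] Pt d)}
    (L : ContinuousMultilinearMap ℝ (fun _ : Fin m => VF d) (VF d))
    (hloc : ∀ (f g : Fin m → VF d) (x : Pt d), (∀ i, (f i : Pt d → Pt d) =ᶠ[𝓝 x] g i) →
      L f x = L g x)
    (heq : ∀ A ∈ H, ∀ (b : Pt d) (f : Fin m → VF d),
      L (fun i => affAct A b (f i)) = affAct A b (L f)) : symmetrize L ∈ linLoc H m := by
  refine ⟨fun τ f => ?_, isLocalMulti_of_germ hm _ fun f g x h => ?_, fun A hA b f => ?_⟩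
  · rw [symmetrize_apply, symmetrize_apply]
    exact Fintype.sum_equiv (Equiv.mulLeft τ) _ _ fun σ => rfl
  · rw [symmetrize_apply, symmetrize_apply, VF.sum_apply, VF.sum_apply]
    exact Finset.sum_congr rfl fun σ _ => hloc _ _ _ fun i => h _
  · rw [symmetrize_apply, symmetrize_apply, affAct_sum]
    exact Finset.sum_congr rfl fun σ _ => heq A hA b _

/-! ### Taylor terms -/

/-- Symmetry of higher derivatives is not needed: averaging the `m`-th derivative over permutations
leaves its polynomial unchanged. Conversely `homPoly L / m!` is an admissible map with Taylor term
`homPoly L`. -/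
theorem taylorTerms_eq_image (hm : 1 ≤ m) (H : Subgroup (Pt d ≃L[ℝ] Pt d)) :
    taylorTerms H m =
      (fun L : ContinuousMultilinearMap ℝ (fun _ : Fin m => VF d) (VF d) => homPoly L) ''
        (linLoc H m : Set _) := by
  ext p
  constructor
  · rintro ⟨φ, T, hloc, heq, ⟨D, hD, rfl⟩, rfl⟩
    refine ⟨(m.factorial : ℝ)⁻¹ • symmetrize (hD.toMultilinear m 0),
      Submodule.smul_mem _ _ (symmetrize_mem_linLoc hm _ (fun f g x h => ?_)
        fun A hA b f => ?_), ?_⟩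
    · exact hD.congr_of_germ hloc m EventuallyEq.rfl h
    · have h0 : affAct A b (0 : VF d) = 0 := VF.ext fun x => map_zero A
      have := hD.equivariant (heq A hA b) m 0 f
      rw [h0] at this
      exact this
    · have h1 := homPoly_symmetrize (hD.toMultilinear m 0)
      have h2 : homPoly ((m.factorial : ℝ)⁻¹ • symmetrize (hD.toMultilinear m 0) :
          ContinuousMultilinearMap ℝ (fun _ : Fin m => VF d) (VF d)) =
          (m.factorial : ℝ)⁻¹ • homPoly (symmetrize (hD.toMultilinear m 0)) := rfl
      simp only [h2, h1, smul_smul]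
      rw [inv_mul_cancel₀ (by exact_mod_cast m.factorial_ne_zero), one_smul]
      rfl
  · rintro ⟨L, ⟨hsymm, hloc, heq⟩, rfl⟩
    refine ⟨_, _, ⟨fun f => ?_, fun f g x h => ?_⟩, fun A hA b f => ?_,
      ⟨_, hasDerivatives_homPoly L hsymm, rfl⟩, ?_⟩
    · refine (closure_mono (Function.support_const_smul_subset (m.factorial : ℝ)⁻¹
        (homPoly L f : Pt d → Pt d))).trans ((hloc.1 _).trans ?_)
      exact Set.iUnion_subset fun _ => subset_rfl
    · change (m.factorial : ℝ)⁻¹ • (homPoly L f x) = (m.factorial : ℝ)⁻¹ • (homPoly L g x)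
      rw [homPoly, homPoly, hloc.2 _ _ x fun _ => h]
    · simp only [homPoly]
      rw [heq A hA b fun _ => f]
      exact VF.ext fun x => (map_smul A _ _).symm
    · funext f
      exact (taylorTerm_homPoly L hsymm _).symm

/-! ### Vector fields with prescribed jets -/

/-- The homogeneous polynomial vector field of degree `j` with given `j`-th derivative at `0`. -/
def homField (j : ℕ) : symJet d j →ₗ[ℝ] VF d where
  toFun z := ⟨fun x => (j.factorial : ℝ)⁻¹ • z.1 fun _ => x,
    show ContDiff ℝ ∞ _ from
      (z.1.contDiff.comp (contDiff_pi.2 fun _ => contDiff_id)).const_smul _⟩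
  map_add' z w := VF.ext fun x => smul_add _ (z.1 fun _ => x) (w.1 fun _ => x)
  map_smul' c z := VF.ext fun x => smul_comm _ c (z.1 fun _ => x)

/-- The field is its own power series at `0`, with a single term. The derivative of order `j` sums
that coefficient over all permutations, and symmetry of `z` turns this into `j!` equal terms. -/
theorem iteratedFDeriv_homField (j : ℕ) (z : symJet d j) (n : ℕ) :
    iteratedFDeriv ℝ n (homField j z) 0 =
      (Pi.single j z.1 : (n : ℕ) → Pt d [×n]→L[ℝ] Pt d) n := by
  set p : FormalMultilinearSeries ℝ (Pt d) (Pt d) :=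
    (Pi.single j ((j.factorial : ℝ)⁻¹ • z.1) : (n : ℕ) → Pt d [×n]→L[ℝ] Pt d) with hp
  have hpj : p j = (j.factorial : ℝ)⁻¹ • z.1 := Pi.single_eq_same _ _
  have hpn : ∀ n, n ≠ j → p n = 0 := fun n hn => Pi.single_eq_of_ne hn _
  have h : HasFPowerSeriesOnBall (homField j z : Pt d → Pt d) p 0 ⊤ := by
    refine ⟨?_, ENNReal.zero_lt_top, fun {y} _ => ?_⟩
    · rw [p.radius_eq_top_of_forall_image_add_eq_zero (j + 1) fun n => hpn _ (by omega)]
    · have := hasSum_single (f := fun n => p n fun _ => y) j fun n hn => by rw [hpn n hn]; rfl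
      simpa only [hpj, zero_add] using! this
  ext1 v
  rw [h.iteratedFDeriv_eq_sum_of_completeSpace]
  rcases eq_or_ne n j with rfl | hn
  · rw [Pi.single_eq_same, hpj]
    have : ∀ σ : Equiv.Perm (Fin n), ((n.factorial : ℝ)⁻¹ • z.1) (fun i => v (σ i)) =
        (n.factorial : ℝ)⁻¹ • z.1 v := 
      fun σ => congrArg (fun y => (n.factorial : ℝ)⁻¹ • y) (z.2 σ v)
    rw [Finset.sum_congr rfl fun σ _ => this σ, Finset.sum_const, Finset.card_univ,
      Fintype.card_perm, Fintype.card_fin, ← Nat.cast_smul_eq_nsmul ℝ, smul_smul,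
      mul_inv_cancel₀ (by exact_mod_cast n.factorial_ne_zero), one_smul]
  · rw [Pi.single_eq_of_ne hn, hpn n hn]
    simp

theorem jetPart_homField_self (j : ℕ) (z : symJet d j) : jetPart j (homField j z) = z :=
  Subtype.ext ((iteratedFDeriv_homField j z j).trans (Pi.single_eq_same _ _))

theorem jetPart_homField_of_ne {j n : ℕ} (h : n ≠ j) (z : symJet d j) :
    jetPart n (homField j z) = 0 :=
  Subtype.ext ((iteratedFDeriv_homField j z n).trans (Pi.single_eq_of_ne h _))

theorem jet_homField (k j : ℕ) (z : symJet d j) : jet k (homField j z) = jetSingle k j z := by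
  funext n
  by_cases h : j < k + 1
  · rw [jetSingle, dif_pos h]
    rcases eq_or_ne n ⟨j, h⟩ with rfl | hn
    · rw [Pi.single_eq_same]
      exact jetPart_homField_self j z
    · rw [Pi.single_eq_of_ne hn]
      exact jetPart_homField_of_ne (fun e => hn (Fin.ext e)) z
  · rw [jetSingle, dif_neg h]
    exact jetPart_homField_of_ne (fun e : (n : ℕ) = j => h (e ▸ n.2)) z

/-- The polynomial vector field with a given jet at `0`. -/
def jetField (k : ℕ) : Jet d k →ₗ[ℝ] VF d :=
  ∑ j : Fin (k + 1), homField (j : ℕ) ∘ₗ LinearMap.proj j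

theorem jetField_apply (k : ℕ) (z : Jet d k) :
    jetField k z = ∑ j : Fin (k + 1), homField (j : ℕ) (z j) := by
  simp [jetField]

theorem VF.iterD_apply (k : ℕ) (f : VF d) (x : Pt d) : VF.iterD k f x = iteratedFDeriv ℝ k f x :=
  rfl

theorem iteratedFDeriv_jetField (k : ℕ) (z : Jet d k) (j : Fin (k + 1)) :
    iteratedFDeriv ℝ j (jetField k z) 0 = (z j).1 := by
  rw [jetField_apply, ← VF.iterD_apply, map_sum, ContinuousMap.sum_apply,
    Finset.sum_eq_single j]
  · exact congrArg Subtype.val (jetPart_homField_self (j : ℕ) (z j))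
  · exact fun n _ hn => congrArg Subtype.val (jetPart_homField_of_ne
      (fun e => hn (Fin.ext e.symm)) (z n))
  · simp

/-! ### Fields with vanishing jet have germs of small representatives -/

/-- Taylor's estimate: starting from a bound on the derivative of order `k + 1`, each step down in
order gains a factor `‖x‖` by the mean value inequality, since the lower derivatives vanish at `0`.
-/
theorem exists_bound_iteratedFDeriv (k : ℕ) (h : VF d)
    (h0 : ∀ j ≤ k, iteratedFDeriv ℝ j h 0 = 0) :
    ∃ C : ℝ, 0 ≤ C ∧ ∀ j ≤ k, ∀ x : Pt d, ‖x‖ ≤ 2 →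
      ‖iteratedFDeriv ℝ j h x‖ ≤ C * ‖x‖ ^ (k + 1 - j) := by
  obtain ⟨C, hC⟩ := (isCompact_closedBall (0 : Pt d) 2).exists_bound_of_continuousOn
    (f := iteratedFDeriv ℝ (k + 1) h)
    (h.contDiff.continuous_iteratedFDeriv (by exact_mod_cast le_top)).continuousOn
  have hC0 : 0 ≤ C := (norm_nonneg _).trans (hC 0 (by simp))
  have key : ∀ i ≤ k + 1, ∀ x : Pt d, ‖x‖ ≤ 2 →
      ‖iteratedFDeriv ℝ (k + 1 - i) h x‖ ≤ C * ‖x‖ ^ i := by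
    intro i
    induction i with
    | zero => intro _ x hx; simpa using hC x (by simpa using hx)
    | succ i ih =>
      intro hi x hx
      have hd : Differentiable ℝ (iteratedFDeriv ℝ (k + 1 - (i + 1)) h) :=
        h.contDiff.differentiable_iteratedFDeriv (WithTop.coe_lt_coe.2 (ENat.natCast_lt_top _))
      have hb : ∀ y ∈ Metric.closedBall (0 : Pt d) ‖x‖,
          ‖fderiv ℝ (iteratedFDeriv ℝ (k + 1 - (i + 1)) h) y‖ ≤ C * ‖x‖ ^ i := by
        intro y hy
        have hy' : ‖y‖ ≤ ‖x‖ := by simpa using hy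
        rw [norm_fderiv_iteratedFDeriv, show k + 1 - (i + 1) + 1 = k + 1 - i by omega]
        exact (ih (by omega) y (hy'.trans hx)).trans (by gcongr)
      have := (convex_closedBall (0 : Pt d) ‖x‖).norm_image_sub_le_of_norm_fderiv_le
        (fun y _ => hd y) hb (Metric.mem_closedBall_self (norm_nonneg x))
        (show x ∈ Metric.closedBall (0 : Pt d) ‖x‖ by simp)
      rw [h0 _ (by omega), sub_zero, sub_zero] at this
      rwa [pow_succ, ← mul_assoc]
  refine ⟨C, hC0, fun j hj x hx => ?_⟩
  have := key (k + 1 - j) (by omega) x hx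
  rwa [show k + 1 - (k + 1 - j) = j by omega] at this

theorem exists_bound_bump (χ : ContDiffBump (0 : Pt d)) (k : ℕ) :
    ∃ M : ℝ, 0 ≤ M ∧ ∀ i ≤ k, ∀ x, ‖iteratedFDeriv ℝ i χ x‖ ≤ M := by
  have h1 : ∀ i : ℕ, ∃ M : ℝ, ∀ x, ‖iteratedFDeriv ℝ i χ x‖ ≤ M := fun i =>
    (χ.hasCompactSupport.iteratedFDeriv i).exists_bound_of_continuous
      ((χ.contDiff (n := (i : ℕ∞))).continuous_iteratedFDeriv le_rfl)
  choose M hM using h1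
  refine ⟨∑ i ∈ Finset.range (k + 1), |M i|, Finset.sum_nonneg fun _ _ => abs_nonneg _,
    fun i hi x => (hM i x).trans ((le_abs_self _).trans ?_)⟩
  exact Finset.single_le_sum (f := fun i => |M i|) (fun _ _ => abs_nonneg _)
    (Finset.mem_range.2 (by omega))

/-- Cut off `h` at scale `ε`. In the Leibniz formula for order `n`, `i` derivatives of the cutoff
cost `ε⁻¹ ^ i`, while the remaining derivative of `h` is of size `ε ^ (k + 1 - n + i)`. So every
term is of order `ε ^ (k + 1 - n)`, hence at most of order `ε`. -/
theorem exists_germ_eq_small (k : ℕ) (h : VF d) (h0 : ∀ j ≤ k, iteratedFDeriv ℝ j h 0 = 0)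
    {δ : ℝ} (hδ : 0 < δ) :
    ∃ g : VF d, (g : Pt d → Pt d) =ᶠ[𝓝 0] h ∧
      ∀ j ≤ k, ∀ x, ‖iteratedFDeriv ℝ j g x‖ ≤ δ := by
  obtain ⟨C, hC0, hC⟩ := exists_bound_iteratedFDeriv k h h0
  let χ : ContDiffBump (0 : Pt d) := ⟨1, 2, one_pos, one_lt_two⟩
  obtain ⟨M, hM0, hM⟩ := exists_bound_bump χ k
  -- `2 ^ k` bounds the sum of the binomial coefficients, and `2 ^ (k + 1)` comes from `‖x‖ ≤ 2 * ε`
  -- on the support of the cutoff.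
  set Q : ℝ := 2 ^ k * (M * C * 2 ^ (k + 1)) with hQ
  have hQ0 : 0 ≤ Q := by positivity
  set ε : ℝ := min 1 (δ / (Q + 1)) with hε
  have hε0 : 0 < ε := lt_min one_pos (by positivity)
  have hε1 : ε ≤ 1 := min_le_left _ _
  have hεQ : Q * ε ≤ δ := by
    have h1 : ε ≤ δ / (Q + 1) := min_le_right _ _
    rw [le_div_iff₀ (by positivity)] at h1
    nlinarith
  have hχ : ContDiff ℝ ∞ fun x : Pt d => χ (ε⁻¹ • x) :=
    χ.contDiff.comp (contDiff_id.const_smul ε⁻¹)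
  have hDχ : ∀ i ≤ k, ∀ x, ‖iteratedFDeriv ℝ i (fun x : Pt d => χ (ε⁻¹ • x)) x‖ ≤
      (ε⁻¹) ^ i * M := by
    intro i hi x
    rw [iteratedFDeriv_comp_const_smul _ χ.contDiff, norm_smul, norm_pow, norm_inv,
      Real.norm_of_nonneg hε0.le]
    gcongr
    exact hM i hi _
  refine ⟨⟨fun x => χ (ε⁻¹ • x) • h x, hχ.smul h.contDiff⟩, ?_, fun n hn x => ?_⟩
  · filter_upwards [Metric.ball_mem_nhds (0 : Pt d) hε0] with x hx
    have hx' : ‖x‖ < ε := by simpa using hx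
    have : χ (ε⁻¹ • x) = 1 := by
      refine χ.one_of_mem_closedBall ?_
      rw [mem_closedBall_zero_iff, norm_smul, norm_inv, Real.norm_of_nonneg hε0.le]
      change _ ≤ (1 : ℝ)
      rw [inv_mul_le_iff₀ hε0]
      linarith
    change χ (ε⁻¹ • x) • h x = h x
    rw [this, one_smul]
  · change ‖iteratedFDeriv ℝ n (fun x => χ (ε⁻¹ • x) • h x) x‖ ≤ δ
    by_cases hx : ‖x‖ ≤ 2 * ε
    · have hx2 : ‖x‖ ≤ 2 := by linarith
      refine (norm_iteratedFDeriv_smul_le hχ h.contDiff x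
        (by exact_mod_cast le_top)).trans (le_trans ?_ hεQ)
      have hterm : ∀ i ∈ Finset.range (n + 1), (n.choose i : ℝ) *
          ‖iteratedFDeriv ℝ i (fun x : Pt d => χ (ε⁻¹ • x)) x‖ *
          ‖iteratedFDeriv ℝ (n - i) h x‖ ≤ n.choose i * (M * C * 2 ^ (k + 1) * ε) := by
        intro i hi
        have hin : i ≤ n := by simpa [Nat.lt_succ_iff] using hi
        rw [mul_assoc]
        refine mul_le_mul_of_nonneg_left ?_ (Nat.cast_nonneg _)
        have h1 : ‖iteratedFDeriv ℝ (n - i) h x‖ ≤ C * (2 * ε) ^ (k + 1 - n + i) := by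
          refine (hC (n - i) (by omega) x hx2).trans ?_
          rw [show k + 1 - (n - i) = k + 1 - n + i by omega]
          gcongr
        calc _ ≤ ((ε⁻¹) ^ i * M) * (C * (2 * ε) ^ (k + 1 - n + i)) :=
              mul_le_mul (hDχ i (by omega) x) h1 (norm_nonneg _) (by positivity)
          _ = M * C * (2 ^ (k + 1 - n + i) * ε ^ (k + 1 - n)) := by
              rw [mul_pow, pow_add ε, inv_pow]
              field_simp
          _ ≤ M * C * (2 ^ (k + 1) * ε) := by
              refine mul_le_mul_of_nonneg_left (mul_le_mul
                (pow_le_pow_right₀ one_le_two (by omega))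
                (pow_le_of_le_one hε0.le hε1 (by omega)) (by positivity) (by positivity))
                (by positivity)
          _ = _ := by ring
      refine (Finset.sum_le_sum hterm).trans ?_
      rw [← Finset.sum_mul]
      have h2 : ∑ i ∈ Finset.range (n + 1), (n.choose i : ℝ) = 2 ^ n := by
        exact_mod_cast Nat.sum_range_choose n
      have h3 : (2 : ℝ) ^ n ≤ 2 ^ k := pow_le_pow_right₀ one_le_two hn
      calc _ ≤ 2 ^ k * (M * C * 2 ^ (k + 1) * ε) := by rw [h2]; gcongr
        _ = Q * ε := by rw [hQ]; ring
    · have hz : (fun x => χ (ε⁻¹ • x) • h x) =ᶠ[𝓝 x] fun _ => (0 : Pt d) := by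
        have ho : {y : Pt d | 2 * ε < ‖y‖} ∈ 𝓝 x :=
          (isOpen_lt continuous_const continuous_norm).mem_nhds (not_le.1 hx)
        filter_upwards [ho] with y hy
        have : χ (ε⁻¹ • y) = 0 := by
          refine χ.zero_of_le_dist ?_
          rw [dist_zero_right, norm_smul, norm_inv, Real.norm_of_nonneg hε0.le]
          change (2 : ℝ) ≤ _
          rw [le_inv_mul_iff₀ hε0]
          have : 2 * ε < ‖y‖ := hy
          linarith
        rw [this, zero_smul]
      rw [(EventuallyEq.iteratedFDeriv ℝ hz n).eq_of_nhds]
      have : iteratedFDeriv ℝ n (fun _ : Pt d => (0 : Pt d)) = 0 := iteratedFDeriv_fun_zero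
      rw [this, Pi.zero_apply, norm_zero]
      exact hδ.le

/-! ### Local multilinear maps have finite order -/

/-- A neighbourhood constrains finitely many derivatives on compact sets; bounds on all of `ℝ^d` are
stronger, and suffice for the cut-off fields used later. -/
theorem exists_ball_subset_of_mem_nhds_zero {U : Set (VF d)} (hU : U ∈ 𝓝 (0 : VF d)) :
    ∃ (k : ℕ) (δ : ℝ), 0 < δ ∧
      ∀ g : VF d, (∀ j ≤ k, ∀ x, ‖iteratedFDeriv ℝ j g x‖ ≤ δ) → g ∈ U := by
  have hn : 𝓝 (0 : VF d) = ⨅ k : ℕ, comap (VF.iterD (d := d) k) (𝓝 0) := by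
    rw [nhds_iInf]
    simp only [nhds_induced, map_zero]
  rw [hn] at hU
  refine Filter.iInf_sets_induct hU ⟨0, 1, one_pos, fun _ _ => trivial⟩ ?_
  · rintro k s₁ s₂ h1 ⟨k', δ', hδ', h'⟩
    obtain ⟨V, hV, hVs⟩ := h1
    obtain ⟨W, hW, hWV⟩ := (UniformSpace.mem_nhds_iff
      (α := C(Pt d, Pt d [×k]→L[ℝ] Pt d))).1 hV
    rw [ContinuousMap.mem_compactConvergence_entourage_iff] at hW
    obtain ⟨K, Z, -, hZ, hKZ⟩ := hW
    obtain ⟨δ, hδ, hδZ⟩ := Metric.mem_uniformity_dist.1 hZ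
    refine ⟨max k k', min (δ / 2) δ', lt_min (by positivity) hδ', fun g hg => ⟨?_, ?_⟩⟩
    · refine hVs (hWV (hKZ fun x _ => hδZ ?_))
      rw [ContinuousMap.zero_apply, dist_zero_left]
      have := (hg k (le_max_left _ _) x).trans (min_le_left _ _)
      change ‖iteratedFDeriv ℝ k g x‖ < δ
      linarith
    · exact h' g fun j hj x => (hg j (hj.trans (le_max_right _ _)) x).trans (min_le_right _ _)

/-- Vanishing of the `k`-jet of one argument is enough. That argument is replaced by a field with
the same germ, so small that even after division by the supposed nonzero value `r` it stays in the
neighbourhood where `‖L f 0‖ < 1`; but the value then has norm exactly `1`. -/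
theorem exists_order (hm : 1 ≤ m) (L : ContinuousMultilinearMap ℝ (fun _ : Fin m => VF d) (VF d))
    (hL : IsLocalMulti L) :
    ∃ k : ℕ, ∀ (f : Fin m → VF d) (i : Fin m), (∀ j ≤ k, iteratedFDeriv ℝ j (f i) 0 = 0) →
      L f 0 = 0 := by
  have hnb : {f : Fin m → VF d | ‖L f 0‖ < 1} ∈ 𝓝 (0 : Fin m → VF d) := by
    have hc : Continuous fun f : Fin m → VF d => ‖L f 0‖ :=
      ((VF.eval 0).continuous.comp L.cont).norm
    refine (isOpen_lt hc continuous_const).mem_nhds ?_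
    have : L 0 = 0 := L.map_coord_zero (⟨0, hm⟩ : Fin m) rfl
    simp [this, VF.zero_apply]
  rw [nhds_pi, Filter.mem_pi] at hnb
  obtain ⟨I, -, t, ht, hIt⟩ := hnb
  have hU : (⋂ i, t i) ∈ 𝓝 (0 : VF d) := Filter.iInter_mem.2 ht
  have hUt : ∀ f : Fin m → VF d, (∀ j, f j ∈ ⋂ i, t i) → ‖L f 0‖ < 1 := fun f hf =>
    hIt fun i _ => Set.mem_iInter.1 (hf i) i
  obtain ⟨k, δ, hδ, hk⟩ := exists_ball_subset_of_mem_nhds_zero hU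
  refine ⟨k, fun f i hf => ?_⟩
  -- The arguments are scaled into the neighbourhood by a common nonzero factor, which
  -- multilinearity removes at the end.
  obtain ⟨s, hs0, hs⟩ : ∃ s : ℝ, s ≠ 0 ∧ ∀ j, s • f j ∈ ⋂ i, t i := by
    have h1 : ∀ᶠ s : ℝ in 𝓝[≠] 0, ∀ j, s • f j ∈ ⋂ i, t i := by
      refine eventually_all.2 fun j => ?_
      have : Tendsto (fun s : ℝ => s • f j) (𝓝[≠] 0) (𝓝 0) :=
        Tendsto.mono_left (by
          simpa using (continuous_id.fun_smul (continuous_const (y := f j))).tendsto (0 : ℝ))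
          nhdsWithin_le_nhds
      exact this hU
    obtain ⟨s, h1, h2⟩ := (h1.and self_mem_nhdsWithin).exists
    exact ⟨s, h2, h1⟩
  set F : Fin m → VF d := fun j => s • f j with hF
  have ha : L (Function.update F i (f i)) 0 = 0 := by
    by_contra hne
    set r : ℝ := ‖L (Function.update F i (f i)) 0‖ with hr
    have hr0 : 0 < r := norm_pos_iff.2 hne
    obtain ⟨g, hg1, hg2⟩ := exists_germ_eq_small k (f i) hf (mul_pos hδ hr0)
    have hmem : r⁻¹ • g ∈ ⋂ i, t i := by
      refine hk _ fun j hj x => ?_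
      rw [← VF.iterD_apply, map_smul, ContinuousMap.smul_apply, norm_smul, norm_inv,
        Real.norm_of_nonneg hr0.le, inv_mul_le_iff₀ hr0, mul_comm]
      exact hg2 j hj x
    have h1 := hUt (Function.update F i (r⁻¹ • g)) fun j => by
      rcases eq_or_ne j i with rfl | hj
      · rwa [Function.update_self]
      · rw [Function.update_of_ne hj]; exact hs j
    have h2 : L (Function.update F i g) 0 = L (Function.update F i (f i)) 0 := by
      refine hL.2 _ _ 0 fun j => ?_
      rcases eq_or_ne j i with rfl | hj
      · simpa only [Function.update_self] using hg1
      · simp only [Function.update_of_ne hj]; exact EventuallyEq.rfl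
    rw [L.map_update_smul, VF.smul_apply, h2, norm_smul, norm_inv, ← hr,
      Real.norm_of_nonneg hr0.le, inv_mul_cancel₀ hr0.ne'] at h1
    exact lt_irrefl _ h1
  have h1 : L F 0 = 0 := by
    rw [← Function.update_eq_self i F, hF, L.map_update_smul, VF.smul_apply, ← hF, ha, smul_zero]
  rw [hF, L.map_smul_univ, VF.smul_apply, smul_eq_zero] at h1
  exact h1.resolve_left (Finset.prod_ne_zero_iff.2 fun _ _ => hs0)

/-- In the expansion of `L ((f - g) + g)`, every term that contains a difference has an argument
with vanishing `k`-jet. -/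
theorem eq_of_jet_eq {L : ContinuousMultilinearMap ℝ (fun _ : Fin m => VF d) (VF d)} {k : ℕ}
    (hk : ∀ (f : Fin m → VF d) (i : Fin m), (∀ j ≤ k, iteratedFDeriv ℝ j (f i) 0 = 0) →
      L f 0 = 0) {f g : Fin m → VF d}
    (h : ∀ i, ∀ j ≤ k, iteratedFDeriv ℝ j (f i) 0 = iteratedFDeriv ℝ j (g i) 0) :
    L f 0 = L g 0 := by
  have h1 : L f = L ((f - g) + g) := by rw [sub_add_cancel]
  rw [h1, L.map_add_univ, VF.sum_apply, Finset.sum_eq_single ∅, Finset.piecewise_empty]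
  · intro s _ hs
    obtain ⟨i, hi⟩ := Finset.nonempty_iff_ne_empty.2 hs
    refine hk _ i fun j hj => ?_
    rw [Finset.piecewise_eq_of_mem _ _ _ hi, ← VF.iterD_apply, Pi.sub_apply, map_sub,
      ContinuousMap.sub_apply, VF.iterD_apply, VF.iterD_apply, h i j hj, sub_self]
  · simp

/-- The multilinear function on jets at `0` induced by a multilinear map on vector fields. -/
def jetForm (L : ContinuousMultilinearMap ℝ (fun _ : Fin m => VF d) (VF d)) (k : ℕ) :
    MultilinearMap ℝ (fun _ : Fin m => Jet d k) (Pt d) :=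
  (VF.eval 0).toLinearMap.compMultilinearMap
    (L.toMultilinearMap.compLinearMap fun _ => jetField k)

theorem eval_zero_eq_jetForm {L : ContinuousMultilinearMap ℝ (fun _ : Fin m => VF d) (VF d)}
    {k : ℕ} (hk : ∀ (f : Fin m → VF d) (i : Fin m),
      (∀ j ≤ k, iteratedFDeriv ℝ j (f i) 0 = 0) → L f 0 = 0) (f : Fin m → VF d) :
    L f 0 = jetForm L k fun i => jet k (f i) :=
  eq_of_jet_eq hk (g := fun i => jetField k (jet k (f i))) fun i j hj =>
    (iteratedFDeriv_jetField k (jet k (f i)) ⟨j, Nat.lt_succ_of_le hj⟩).symm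

/-- A local multilinear map vanishes at `0` if it does so on homogeneous polynomials. -/
theorem eval_zero_eq_zero {L : ContinuousMultilinearMap ℝ (fun _ : Fin m => VF d) (VF d)}
    (hm : 1 ≤ m) (hL : IsLocalMulti L)
    (h : ∀ (δ : Fin m → ℕ) (z : ∀ i, symJet d (δ i)), L (fun i => homField (δ i) (z i)) 0 = 0)
    (f : Fin m → VF d) : L f 0 = 0 := by
  obtain ⟨k, hk⟩ := exists_order hm L hL
  rw [eval_zero_eq_jetForm hk]
  change L (fun i => jetField k (jet k (f i))) 0 = 0
  simp only [jetField_apply]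
  rw [L.map_sum, VF.sum_apply]
  exact Finset.sum_eq_zero fun r _ => h (fun i => r i) fun i => jet k (f i) (r i)

/-! ### Smooth functions of jets -/

/-- A multilinear map on finite-dimensional spaces is smooth. -/
theorem contDiff_multilinear {ι : Type*} [Fintype ι] {E : ι → Type*} {F : Type*}
    [∀ i, NormedAddCommGroup (E i)] [∀ i, NormedSpace ℝ (E i)] [∀ i, FiniteDimensional ℝ (E i)]
    [NormedAddCommGroup F] [NormedSpace ℝ F] (t : MultilinearMap ℝ E F) : ContDiff ℝ ∞ t := by
  classical
  let b := fun i => Module.finBasis ℝ (E i)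
  have h : (t : (∀ i, E i) → F) = fun w => ∑ r : ∀ i, Fin (Module.finrank ℝ (E i)),
      (∏ i, (b i).coord (r i) (w i)) • t fun i => b i (r i) := by
    funext w
    conv_lhs => rw [← funext fun i => (b i).sum_repr (w i)]
    rw [t.map_sum]
    refine Finset.sum_congr rfl fun r _ => ?_
    rw [t.map_smul_univ]
    rfl
  rw [h]
  refine ContDiff.sum fun r _ => ContDiff.smul (contDiff_prod fun i _ => ?_) contDiff_const
  exact ((b i).coord (r i)).toContinuousLinearMap.contDiff.comp 
    (ContinuousLinearMap.proj (R := ℝ) (φ := E) i).contDiff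

instance finiteDimensional_continuousMultilinearMap (j : ℕ) :
    FiniteDimensional ℝ (Pt d [×j]→L[ℝ] Pt d) :=
  Module.Finite.of_injective
    ({ toFun := ContinuousMultilinearMap.toMultilinearMap
       map_add' := fun _ _ => rfl
       map_smul' := fun _ _ => rfl } :
      (Pt d [×j]→L[ℝ] Pt d) →ₗ[ℝ] MultilinearMap ℝ (fun _ : Fin j => Pt d) (Pt d))
    ContinuousMultilinearMap.toMultilinearMap_injective

theorem VF.contDiff_iteratedFDeriv (f : VF d) (j : ℕ) : ContDiff ℝ ∞ (iteratedFDeriv ℝ j f) :=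
  f.contDiff.iteratedFDeriv_right (by exact_mod_cast le_top)

theorem contDiff_comp_jets {ι F : Type*} [Fintype ι] [NormedAddCommGroup F] [NormedSpace ℝ F]
    (a : ι → ℕ) (c : ι → Fin m) {Ψ : (∀ q, Pt d [×a q]→L[ℝ] Pt d) → F} (hΨ : ContDiff ℝ ∞ Ψ)
    (f : Fin m → VF d) :
    ContDiff ℝ ∞ fun x => Ψ fun q => iteratedFDeriv ℝ (a q) (f (c q)) x :=
  hΨ.comp (contDiff_pi.2 fun q => (f (c q)).contDiff_iteratedFDeriv (a q))

/-- The derivatives of a smooth function of the jets of vector fields depend continuously on the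
vector fields and on the point. -/
theorem continuous_iteratedFDeriv_comp_jets (n : ℕ) :
    ∀ {ι F : Type} [Fintype ι] [NormedAddCommGroup F] [NormedSpace ℝ F]
      (a : ι → ℕ) (c : ι → Fin m) {Ψ : (∀ q, Pt d [×a q]→L[ℝ] Pt d) → F}, ContDiff ℝ ∞ Ψ →
      Continuous fun p : (Fin m → VF d) × Pt d =>
        iteratedFDeriv ℝ n (fun x => Ψ fun q => iteratedFDeriv ℝ (a q) (p.1 (c q)) x) p.2 := by
  induction n with
  | zero =>
    intro ι F _ _ _ a c Ψ hΨ
    refine (continuousMultilinearCurryFin0 ℝ (Pt d) F).symm.continuous.comp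
      (hΨ.continuous.comp (continuous_pi fun q => ?_))
    exact VF.continuous_iteratedFDeriv (a q) ((continuous_apply (c q)).comp continuous_fst)
      continuous_snd
  | succ n ih =>
    intro ι F _ _ _ a c Ψ hΨ
    -- By the chain rule the derivative is again a smooth function `Ψ'` of jets: the left copy of
    -- `ι` holds the old jets, where `fderiv ℝ Ψ` is taken, and the right copy the jets one order
    -- higher. The induction therefore runs over all `ι`, `F` and `Ψ`.
    let a' : ι ⊕ ι → ℕ := Sum.elim a fun q => a q + 1
    let Ψ' : (∀ q, Pt d [×a' q]→L[ℝ] Pt d) → (Pt d →L[ℝ] F) := fun w =>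
      (fderiv ℝ Ψ fun q => w (Sum.inl q)).comp (ContinuousLinearMap.pi fun q =>
        continuousMultilinearCurryLeftEquiv ℝ (fun _ : Fin (a q + 1) => Pt d) (Pt d)
          (w (Sum.inr q)))
    have hΨ' : ContDiff ℝ ∞ Ψ' := by
      rw [contDiff_clm_apply_iff]
      intro y
      refine ContDiff.clm_apply (f := fun w : (∀ q, Pt d [×a' q]→L[ℝ] Pt d) =>
          fderiv ℝ Ψ fun q => w (Sum.inl q))
        ((hΨ.fderiv_right (m := ∞) (by exact_mod_cast le_top)).comp
          (ContinuousLinearMap.pi fun q => ContinuousLinearMap.proj (R := ℝ)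
            (φ := fun q => Pt d [×a' q]→L[ℝ] Pt d) (Sum.inl q)).contDiff)
        (contDiff_pi.2 fun q => ?_)
      exact (ContDiff.clm_apply ((continuousMultilinearCurryLeftEquiv ℝ
        (fun _ : Fin (a q + 1) => Pt d) (Pt d)).contDiff.comp
          (ContinuousLinearMap.proj (R := ℝ)
            (φ := fun q => Pt d [×a' q]→L[ℝ] Pt d) (Sum.inr q)).contDiff)
        contDiff_const)
    have hfd : ∀ (f : Fin m → VF d),
        (fderiv ℝ fun x => Ψ fun q => iteratedFDeriv ℝ (a q) (f (c q)) x) =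
          fun x => Ψ' fun q => iteratedFDeriv ℝ (a' q) (f (Sum.elim c c q)) x := by
      intro f
      funext x
      have h1 : HasFDerivAt (fun x => fun q => iteratedFDeriv ℝ (a q) (f (c q)) x)
          (ContinuousLinearMap.pi fun q =>
            continuousMultilinearCurryLeftEquiv ℝ (fun _ : Fin (a q + 1) => Pt d) (Pt d)
              (iteratedFDeriv ℝ (a q + 1) (f (c q)) x)) x := by
        refine hasFDerivAt_pi.2 fun q => ?_
        have := (((f (c q)).contDiff_iteratedFDeriv (a q)).differentiable
          (by simp)).differentiableAt (x := x) |>.hasFDerivAt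
        rwa [fderiv_iteratedFDeriv] at this
      have h2 := ((hΨ.differentiable (by simp))
        (fun q => iteratedFDeriv ℝ (a q) (f (c q)) x)).hasFDerivAt.comp x h1
      exact h2.fderiv
    simp only [iteratedFDeriv_succ_eq_comp_right, Function.comp_apply, hfd]
    exact (continuousMultilinearCurryRightEquiv' ℝ n (Pt d) F).symm.continuous.comp
      (ih a' (Sum.elim c c) hΨ')

/-! ### The differential operator of a multilinear function of jets -/

/-- The degree-`j` part of the jet at a point. -/
def jetAt (x : Pt d) (j : ℕ) : VF d →ₗ[ℝ] symJet d j where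
  toFun f := ⟨iteratedFDeriv ℝ j f x, fun σ v => iteratedFDeriv_perm f.contDiff j σ x v⟩
  map_add' f g := Subtype.ext (DFunLike.congr_fun ((VF.iterD j).map_add f g) x)
  map_smul' c f := Subtype.ext (DFunLike.congr_fun ((VF.iterD j).map_smul c f) x)

/-- `t` sees only symmetric jets, whereas `iteratedFDeriv` takes values in all multilinear maps;
linear projections onto the symmetric ones bridge the gap. -/
theorem exists_contDiff_extension {κ : ℕ →₀ ℕ} [Fintype (Σ j : ℕ, Fin (κ j))]
    (t : MultilinearMap ℝ (fun p : (Σ j : ℕ, Fin (κ j)) => symJet d p.1) (Pt d)) :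
    ∃ Ψ : (∀ p : (Σ j : ℕ, Fin (κ j)), Pt d [×p.1]→L[ℝ] Pt d) → Pt d, ContDiff ℝ ∞ Ψ ∧
      ∀ z : (p : Σ j : ℕ, Fin (κ j)) → symJet d p.1, Ψ (fun p => (z p).1) = t z := by
  have h : ∀ j, ∃ g : (Pt d [×j]→L[ℝ] Pt d) →ₗ[ℝ] symJet d j,
      g ∘ₗ (symJet d j).subtype = LinearMap.id := fun j =>
    LinearMap.exists_leftInverse_of_injective _ (Submodule.ker_subtype _)
  choose g hg using h
  refine ⟨t.compLinearMap fun p => g p.1, contDiff_multilinear _, fun z => ?_⟩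
  rw [MultilinearMap.compLinearMap_apply]
  exact congrArg t (funext fun p => LinearMap.congr_fun (hg p.1) (z p))

/-- The multilinear differential operator `f ↦ (x ↦ t(jets of f at x))`. -/
def jetOp {κ : ℕ →₀ ℕ} (e : Fin m ≃ Σ j : ℕ, Fin (κ j))
    (t : MultilinearMap ℝ (fun p : (Σ j : ℕ, Fin (κ j)) => symJet d p.1) (Pt d)) :
    ContinuousMultilinearMap ℝ (fun _ : Fin m => VF d) (VF d) where
  toFun f := ⟨fun x => ((t.compLinearMap fun p => jetAt x p.1).domDomCongr e.symm) f, by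
    let _ : Fintype (Σ j : ℕ, Fin (κ j)) := Fintype.ofEquiv _ e
    obtain ⟨Ψ, hΨ, h⟩ := exists_contDiff_extension t
    have h1 := contDiff_comp_jets (fun p : (Σ j : ℕ, Fin (κ j)) => p.1) e.symm hΨ f
    have h2 : (fun x => t fun p => jetAt x p.1 (f (e.symm p))) =
        fun x => Ψ fun p => iteratedFDeriv ℝ p.1 (f (e.symm p)) x :=
      funext fun x => (h fun p => jetAt x p.1 (f (e.symm p))).symm
    change ContDiff ℝ ∞ fun x => t fun p => jetAt x p.1 (f (e.symm p))
    rw [h2]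
    exact h1⟩
  map_update_add' f i a b := VF.ext fun x =>
    ((t.compLinearMap fun p => jetAt x p.1).domDomCongr e.symm).map_update_add f i a b
  map_update_smul' f i c a := VF.ext fun x =>
    ((t.compLinearMap fun p => jetAt x p.1).domDomCongr e.symm).map_update_smul f i c a
  cont := by
    let _ : Fintype (Σ j : ℕ, Fin (κ j)) := Fintype.ofEquiv _ e
    obtain ⟨Ψ, hΨ, h⟩ := exists_contDiff_extension t
    refine VF.continuous_of_iteratedFDeriv fun n => ?_
    refine (continuous_iteratedFDeriv_comp_jets n (fun p : (Σ j : ℕ, Fin (κ j)) => p.1)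
      e.symm hΨ).congr fun p => ?_
    exact congrArg (fun g : Pt d → Pt d => iteratedFDeriv ℝ n g p.2)
      (funext fun x => h fun q => jetAt x q.1 (p.1 (e.symm q)))

theorem jetOp_apply {κ : ℕ →₀ ℕ} (e : Fin m ≃ Σ j : ℕ, Fin (κ j))
    (t : MultilinearMap ℝ (fun p : (Σ j : ℕ, Fin (κ j)) => symJet d p.1) (Pt d))
    (f : Fin m → VF d) (x : Pt d) :
    jetOp e t f x = t fun p => jetAt x p.1 (f (e.symm p)) := rfl

theorem jetOp_congr_of_germ {κ : ℕ →₀ ℕ} (e : Fin m ≃ Σ j : ℕ, Fin (κ j))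
    (t : MultilinearMap ℝ (fun p : (Σ j : ℕ, Fin (κ j)) => symJet d p.1) (Pt d))
    (f g : Fin m → VF d) (x : Pt d) (h : ∀ i, (f i : Pt d → Pt d) =ᶠ[𝓝 x] g i) :
    jetOp e t f x = jetOp e t g x := by
  rw [jetOp_apply, jetOp_apply]
  exact congrArg t (funext fun p =>
    Subtype.ext (EventuallyEq.iteratedFDeriv ℝ (h (e.symm p)) p.1).eq_of_nhds)

theorem jetAt_affAct (A : Pt d ≃L[ℝ] Pt d) (b : Pt d) (f : VF d) (x : Pt d) (j : ℕ) :
    jetAt x j (affAct A b f) = jetAct A j (jetAt (A.symm (x - b)) j f) := by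
  refine Subtype.ext ?_
  change iteratedFDeriv ℝ j (fun x => (A ∘ (f ∘ A.symm)) (x - b)) x = _
  have hf : ContDiff ℝ ∞ ((f : Pt d → Pt d) ∘ A.symm) := f.contDiff.comp A.symm.contDiff
  have h1 := (A : Pt d →L[ℝ] Pt d).iteratedFDeriv_comp_left (hf.contDiffAt (x := x - b))
    (i := j) (by exact_mod_cast le_top)
  have h2 := (A.symm : Pt d →L[ℝ] Pt d).iteratedFDeriv_comp_right f.contDiff (x - b)
    (i := j) (by exact_mod_cast le_top)
  exact (iteratedFDeriv_comp_sub j b x).trans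
    (h1.trans (congrArg (A : Pt d →L[ℝ] Pt d).compContinuousMultilinearMap h2))

theorem jetAct_inv_jetAct (A : Pt d ≃L[ℝ] Pt d) (j : ℕ) (z : symJet d j) :
    jetAct A⁻¹ j (jetAct A j z) = z := by
  refine Subtype.ext (ContinuousMultilinearMap.ext fun v => ?_)
  change A.symm (A (z.1 fun i => A.symm (A (v i)))) = z.1 v
  simp

theorem symInv_apply_jetAct {κ : ℕ →₀ ℕ} {H : Subgroup (Pt d ≃L[ℝ] Pt d)} (t : symInv κ H)
    {A : Pt d ≃L[ℝ] Pt d} (hA : A ∈ H) (z : (p : Σ j : ℕ, Fin (κ j)) → symJet d p.1) :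
    t.1 (fun p => jetAct A p.1 (z p)) = A (t.1 z) := by
  rw [← t.2.2 A hA]
  simp only [jetAct_inv_jetAct]

theorem jetOp_equivariant {κ : ℕ →₀ ℕ} {H : Subgroup (Pt d ≃L[ℝ] Pt d)}
    (e : Fin m ≃ Σ j : ℕ, Fin (κ j)) (t : symInv κ H) {A : Pt d ≃L[ℝ] Pt d} (hA : A ∈ H)
    (b : Pt d) (f : Fin m → VF d) :
    jetOp e t.1 (fun i => affAct A b (f i)) = affAct A b (jetOp e t.1 f) := by
  refine VF.ext fun x => ?_
  rw [jetOp_apply]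
  simp only [jetAt_affAct]
  exact symInv_apply_jetAct t hA _

/-! ### Compositions -/

theorem nonempty_equiv_sigma (κ : ℕ →₀ ℕ) :
    Nonempty (Fin κ.degree ≃ Σ j : ℕ, Fin (κ j)) := by
  let E : (Σ j : κ.support, Fin (κ j)) ≃ Σ j : ℕ, Fin (κ j) :=
    { toFun := fun p => ⟨p.1, p.2⟩
      invFun := fun p => ⟨⟨p.1, Finsupp.mem_support_iff.2 fun h => (h ▸ p.2 : Fin 0).elim0⟩, p.2⟩
      left_inv := fun _ => rfl
      right_inv := fun _ => rfl }
  refine ⟨(Fintype.equivFinOfCardEq ?_).symm.trans E⟩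
  rw [Fintype.card_sigma]
  simp only [Fintype.card_fin]
  exact Finset.sum_coe_sort κ.support κ

/-- An enumeration of the arguments of the elements of `Sym_κ`. -/
def compEquiv (κ : {κ : ℕ →₀ ℕ // κ.degree = m}) : Fin m ≃ Σ j : ℕ, Fin (κ.1 j) :=
  (finCongr κ.2.symm).trans (nonempty_equiv_sigma κ.1).some

/-- `κ j` counts the arguments of degree `j`, and `e` enumerates the fibres of `δ`. -/
theorem exists_composition (δ : Fin m → ℕ) :
    ∃ (κ : {κ : ℕ →₀ ℕ // κ.degree = m}) (e : Fin m ≃ Σ j : ℕ, Fin (κ.1 j)),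
      ∀ i, (e i).1 = δ i := by
  let κ : ℕ →₀ ℕ := Finsupp.onFinset (Finset.univ.image δ) (fun j => Fintype.card {i // δ i = j})
    fun j hj => by
      obtain ⟨⟨i, hi⟩⟩ := Fintype.card_pos_iff.1 (Nat.pos_of_ne_zero hj)
      exact Finset.mem_image.2 ⟨i, Finset.mem_univ _, hi⟩
  let e : Fin m ≃ Σ j : ℕ, Fin (κ j) := (Equiv.sigmaFiberEquiv δ).symm.trans
    (Equiv.sigmaCongrRight fun j => Fintype.equivFinOfCardEq rfl)
  refine ⟨⟨κ, ?_⟩, e, fun i => rfl⟩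
  exact Fin.equiv_iff_eq.1 ⟨(nonempty_equiv_sigma κ).some.trans e.symm⟩

/-- The restriction of a degree-preserving bijection to the arguments of one degree. -/
def fiberEquiv {κ κ' : ℕ →₀ ℕ} (g : (Σ j : ℕ, Fin (κ j)) ≃ Σ j : ℕ, Fin (κ' j))
    (hg : ∀ p, (g p).1 = p.1) (j : ℕ) : Fin (κ j) ≃ Fin (κ' j) :=
  (Equiv.sigmaSubtype j).symm.trans
    ((g.subtypeEquiv fun p => by rw [hg p]).trans (Equiv.sigmaSubtype j))

/-- A degree-preserving bijection acts separately on each block of equal degree, which is the form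
of symmetry that `symSpace` provides. -/
theorem apply_eq_fiberEquiv {κ κ' : ℕ →₀ ℕ} (g : (Σ j : ℕ, Fin (κ j)) ≃ Σ j : ℕ, Fin (κ' j))
    (hg : ∀ p, (g p).1 = p.1) (p : Σ j : ℕ, Fin (κ j)) :
    g p = ⟨p.1, fiberEquiv g hg p.1 p.2⟩ := by
  have h : ∀ q : {q : Σ j : ℕ, Fin (κ' j) // q.1 = p.1},
      (⟨p.1, Equiv.sigmaSubtype p.1 q⟩ : Σ j : ℕ, Fin (κ' j)) = q.1 := fun q =>
    congrArg Subtype.val ((Equiv.sigmaSubtype p.1).symm_apply_apply q)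
  exact (h ⟨g p, hg p⟩).symm

/-! ### The operator attached to an element of the direct sum -/

theorem eq_of_degree_preserving {κ κ' : ℕ →₀ ℕ}
    (g : (Σ j : ℕ, Fin (κ j)) ≃ Σ j : ℕ, Fin (κ' j)) (hg : ∀ p, (g p).1 = p.1) : κ = κ' :=
  Finsupp.ext fun j => Fin.equiv_iff_eq.1 ⟨fiberEquiv g hg j⟩

/-- The number of permutations of the arguments that preserve their degrees. -/
def fiberPermCard {κ : ℕ →₀ ℕ} (e : Fin m ≃ Σ j : ℕ, Fin (κ j)) : ℕ :=
  (Finset.univ.filter fun σ : Equiv.Perm (Fin m) => ∀ i, (e (σ i)).1 = (e i).1).card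

theorem fiberPermCard_ne_zero {κ : ℕ →₀ ℕ} (e : Fin m ≃ Σ j : ℕ, Fin (κ j)) :
    fiberPermCard e ≠ 0 :=
  Finset.card_ne_zero_of_mem (a := 1) (by simp)

theorem apply_jetPart_homField_of_degree_preserving {κ : ℕ →₀ ℕ}
    {t : MultilinearMap ℝ (fun p : (Σ j : ℕ, Fin (κ j)) => symJet d p.1) (Pt d)}
    (ht : t ∈ symSpace d κ) (g : Equiv.Perm (Σ j : ℕ, Fin (κ j))) (hg : ∀ p, (g p).1 = p.1)
    (z : (p : Σ j : ℕ, Fin (κ j)) → symJet d p.1) :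
    t (fun p => jetPart p.1 (homField (g p).1 (z (g p)))) = t z := by
  rw [← ht (fun j => fiberEquiv g hg j) z]
  refine congrArg t (funext fun p => ?_)
  have h := congrArg (fun q => jetPart p.1 (homField q.1 (z q))) (apply_eq_fiberEquiv g hg p)
  exact h.trans (jetPart_homField_self _ _)

/-- Where degrees disagree, `t` receives the degree-`p.1` jet of a homogeneous field of another
degree, which is zero. -/
theorem apply_jetPart_homField_eq_zero {κ κ' : ℕ →₀ ℕ}
    (t : MultilinearMap ℝ (fun p : (Σ j : ℕ, Fin (κ j)) => symJet d p.1) (Pt d))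
    (g : (Σ j : ℕ, Fin (κ j)) → Σ j : ℕ, Fin (κ' j)) (hg : ¬ ∀ p, (g p).1 = p.1)
    (z : (p : Σ j : ℕ, Fin (κ' j)) → symJet d p.1) :
    t (fun p => jetPart p.1 (homField (g p).1 (z (g p)))) = 0 := by
  obtain ⟨p, hp⟩ := not_forall.1 hg
  exact t.map_coord_zero p (jetPart_homField_of_ne (Ne.symm hp) _)

theorem symmetrize_jetOp_apply_zero {κ κ' : ℕ →₀ ℕ} (e : Fin m ≃ Σ j : ℕ, Fin (κ j))
    (e' : Fin m ≃ Σ j : ℕ, Fin (κ' j))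
    (t : MultilinearMap ℝ (fun p : (Σ j : ℕ, Fin (κ j)) => symJet d p.1) (Pt d))
    (z : (p : Σ j : ℕ, Fin (κ' j)) → symJet d p.1) :
    symmetrize (jetOp e t) (fun i => homField (e' i).1 (z (e' i))) 0 =
      ∑ σ : Equiv.Perm (Fin m), t fun p => jetPart p.1
        (homField (e' (σ (e.symm p))).1 (z (e' (σ (e.symm p))))) := by
  rw [symmetrize_apply, VF.sum_apply]
  rfl

/-- Degree-preserving permutations each contribute `t z`, by the symmetry of `t`; all others
contribute zero. -/
theorem symmetrize_jetOp_self {κ : ℕ →₀ ℕ} (e : Fin m ≃ Σ j : ℕ, Fin (κ j))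
    {t : MultilinearMap ℝ (fun p : (Σ j : ℕ, Fin (κ j)) => symJet d p.1) (Pt d)}
    (ht : t ∈ symSpace d κ) (z : (p : Σ j : ℕ, Fin (κ j)) → symJet d p.1) :
    symmetrize (jetOp e t) (fun i => homField (e i).1 (z (e i))) 0 =
      (fiberPermCard e : ℝ) • t z := by
  classical
  rw [symmetrize_jetOp_apply_zero]
  have hterm : ∀ σ : Equiv.Perm (Fin m), (t fun p => jetPart p.1
      (homField (e (σ (e.symm p))).1 (z (e (σ (e.symm p)))))) =
      if ∀ i, (e (σ i)).1 = (e i).1 then t z else 0 := by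
    intro σ
    split_ifs with h
    · exact apply_jetPart_homField_of_degree_preserving ht ((e.symm.trans σ).trans e)
        (fun p => by simpa using h (e.symm p)) z
    · exact apply_jetPart_homField_eq_zero t (fun p => e (σ (e.symm p)))
        (fun h' => h fun i => by simpa using h' (e i)) z
  rw [Finset.sum_congr rfl fun σ _ => hterm σ, Finset.sum_ite, Finset.sum_const_zero, add_zero,
    Finset.sum_const, Nat.cast_smul_eq_nsmul, fiberPermCard]

theorem symmetrize_jetOp_of_ne {κ κ' : ℕ →₀ ℕ} (h : κ ≠ κ') (e : Fin m ≃ Σ j : ℕ, Fin (κ j))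
    (e' : Fin m ≃ Σ j : ℕ, Fin (κ' j))
    (t : MultilinearMap ℝ (fun p : (Σ j : ℕ, Fin (κ j)) => symJet d p.1) (Pt d))
    (z : (p : Σ j : ℕ, Fin (κ' j)) → symJet d p.1) :
    symmetrize (jetOp e t) (fun i => homField (e' i).1 (z (e' i))) 0 = 0 := by
  rw [symmetrize_jetOp_apply_zero]
  refine Finset.sum_eq_zero fun σ _ => apply_jetPart_homField_eq_zero t
    (fun p => e' (σ (e.symm p))) (fun h' => h ?_) z
  exact eq_of_degree_preserving ((e.symm.trans σ).trans e') h'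

/-- The local operator attached to an invariant element of `Sym_κ`. -/
def compOp (hm : 1 ≤ m) (H : Subgroup (Pt d ≃L[ℝ] Pt d)) (κ : {κ : ℕ →₀ ℕ // κ.degree = m}) :
    symInv κ.1 H →ₗ[ℝ] linLoc H m where
  -- Dividing by the number of surviving permutations, and not by `m!`, makes the component at `κ`
  -- exactly `t`.
  toFun t := ⟨(fiberPermCard (compEquiv κ) : ℝ)⁻¹ • symmetrize (jetOp (compEquiv κ) t.1),
    Submodule.smul_mem _ _ (symmetrize_mem_linLoc hm _ (jetOp_congr_of_germ _ _)
      fun _ hA b f => jetOp_equivariant _ t hA b f)⟩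
  map_add' t t' := by
    refine Subtype.ext ?_
    have : jetOp (compEquiv κ) (t + t').1 = jetOp (compEquiv κ) t.1 + jetOp (compEquiv κ) t'.1 :=
      rfl
    change _ • symmetrize (jetOp (compEquiv κ) (t + t').1) = _ • symmetrize _ + _ • symmetrize _
    rw [this, ← smul_add]
    congr 1
    ext1 f
    simp only [symmetrize_apply, _root_.add_apply, Finset.sum_add_distrib]
  map_smul' c t := by
    refine Subtype.ext ?_
    have : jetOp (compEquiv κ) (c • t).1 = c • jetOp (compEquiv κ) t.1 := rfl
    change _ • symmetrize (jetOp (compEquiv κ) (c • t).1) = c • (_ • symmetrize _)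
    rw [this, smul_comm c]
    congr 1
    ext1 f
    simp only [symmetrize_apply, _root_.smul_apply, Finset.smul_sum]

/-- The local operator attached to an element of the direct sum of the spaces `Sym_κ^H`. -/
def sumOp (hm : 1 ≤ m) (H : Subgroup (Pt d ≃L[ℝ] Pt d)) : SymSum H m →ₗ[ℝ] linLoc H m :=
  DirectSum.toModule ℝ _ _ (compOp hm H)

theorem sumOp_lof (hm : 1 ≤ m) {H : Subgroup (Pt d ≃L[ℝ] Pt d)}
    (κ : {κ : ℕ →₀ ℕ // κ.degree = m}) (t : symInv κ.1 H) :
    sumOp hm H (DirectSum.lof ℝ _ (fun κ : {κ : ℕ →₀ ℕ // κ.degree = m} => symInv κ.1 H) κ t) =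
      compOp hm H κ t := by
  unfold sumOp
  have := DirectSum.toModule_lof (N := linLoc H m) (φ := compOp hm H) ℝ κ t
  exact this

theorem compOp_homField_self (hm : 1 ≤ m) {H : Subgroup (Pt d ≃L[ℝ] Pt d)}
    (κ : {κ : ℕ →₀ ℕ // κ.degree = m}) (t : symInv κ.1 H)
    (z : (p : Σ j : ℕ, Fin (κ.1 j)) → symJet d p.1) :
    (compOp hm H κ t).1 (fun i => homField (compEquiv κ i).1 (z (compEquiv κ i))) 0 = t.1 z := by
  have h := symmetrize_jetOp_self (compEquiv κ) t.2.1 z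
  change (fiberPermCard (compEquiv κ) : ℝ)⁻¹ • (symmetrize (jetOp (compEquiv κ) t.1) _ : VF d) 0 = _
  rw [h, smul_smul, inv_mul_cancel₀ (by exact_mod_cast fiberPermCard_ne_zero _), one_smul]

theorem compOp_homField_of_ne (hm : 1 ≤ m) {H : Subgroup (Pt d ≃L[ℝ] Pt d)}
    {κ κ' : {κ : ℕ →₀ ℕ // κ.degree = m}} (h : κ' ≠ κ) (t : symInv κ'.1 H)
    (z : (p : Σ j : ℕ, Fin (κ.1 j)) → symJet d p.1) :
    (compOp hm H κ' t).1 (fun i => homField (compEquiv κ i).1 (z (compEquiv κ i))) 0 = 0 := by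
  have h' := symmetrize_jetOp_of_ne (fun e => h (Subtype.ext e)) (compEquiv κ') (compEquiv κ) t.1 z
  change (fiberPermCard (compEquiv κ') : ℝ)⁻¹ •
    (symmetrize (jetOp (compEquiv κ') t.1) _ : VF d) 0 = _
  rw [h', smul_zero]

/-- Restriction to jets undoes `sumOp`. This gives injectivity, and identifies the components in the
proof of surjectivity. -/
theorem sumOp_homField_compEquiv (hm : 1 ≤ m) {H : Subgroup (Pt d ≃L[ℝ] Pt d)} (s : SymSum H m)
    (κ : {κ : ℕ →₀ ℕ // κ.degree = m}) (z : (p : Σ j : ℕ, Fin (κ.1 j)) → symJet d p.1) :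
    (sumOp hm H s).1 (fun i => homField (compEquiv κ i).1 (z (compEquiv κ i))) 0 =
      (s κ).1 z := by
  induction s using DirectSum.induction_on with
  | zero => rw [map_zero]; rfl
  | add s s' hs hs' =>
    have h1 : sumOp hm H (s + s') = sumOp hm H s + sumOp hm H s' := (sumOp hm H).map_add s s'
    have h2 : (s + s') κ = s κ + s' κ := DirectSum.add_apply s s' κ
    exact (congrArg (fun L : linLoc H m => L.1 _ 0) h1).trans ((congrArg₂ (· + ·) hs hs').trans
      (congrArg (fun t : symInv κ.1 H => t.1 z) h2).symm)
  | of κ' t =>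
    refine (congrArg (fun L : linLoc H m => L.1 _ 0) (sumOp_lof hm κ' t)).trans ?_
    rcases eq_or_ne κ' κ with rfl | h
    · have h1 := DirectSum.of_eq_same
        (β := fun κ : {κ : ℕ →₀ ℕ // κ.degree = m} => symInv κ.1 H) κ' t
      exact (compOp_homField_self hm κ' t z).trans
        (congrArg (fun t : symInv κ'.1 H => t.1 z) h1).symm
    · have h1 := DirectSum.of_eq_of_ne
        (β := fun κ : {κ : ℕ →₀ ℕ // κ.degree = m} => symInv κ.1 H) κ' κ t h.symm
      have h2 : (0 : symInv κ.1 H).1 z = 0 := rfl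
      exact (compOp_homField_of_ne hm h t z).trans
        (h2.symm.trans (congrArg (fun t : symInv κ.1 H => t.1 z) h1).symm)

/-- Two enumerations differ by a permutation of the arguments, and `L` is symmetric. -/
theorem apply_homField_equiv {H : Subgroup (Pt d ≃L[ℝ] Pt d)} (L : linLoc H m)
    {κ : ℕ →₀ ℕ} (e e' : Fin m ≃ Σ j : ℕ, Fin (κ j))
    (z : (p : Σ j : ℕ, Fin (κ j)) → symJet d p.1) :
    L.1 (fun i => homField (e i).1 (z (e i))) = L.1 fun i => homField (e' i).1 (z (e' i)) := by
  have h := L.2.1 (e.trans e'.symm) fun i => homField (e' i).1 (z (e' i))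
  rw [← h]
  congr 1
  funext i
  exact congrArg (fun p => homField p.1 (z p)) (e'.apply_symm_apply (e i)).symm

theorem sumOp_homField (hm : 1 ≤ m) {H : Subgroup (Pt d ≃L[ℝ] Pt d)} (s : SymSum H m)
    (κ : {κ : ℕ →₀ ℕ // κ.degree = m}) (e : Fin m ≃ Σ j : ℕ, Fin (κ.1 j))
    (z : (p : Σ j : ℕ, Fin (κ.1 j)) → symJet d p.1) :
    (sumOp hm H s).1 (fun i => homField (e i).1 (z (e i))) 0 = (s κ).1 z := by
  rw [apply_homField_equiv _ e (compEquiv κ), sumOp_homField_compEquiv]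

theorem isJetRestriction_sumOp (hm : 1 ≤ m) {H : Subgroup (Pt d ≃L[ℝ] Pt d)} (s : SymSum H m) :
    IsJetRestriction (sumOp hm H s).1 s := by
  obtain ⟨k, hk⟩ := exists_order hm _ (sumOp hm H s).2.2.1
  refine ⟨k, jetForm (sumOp hm H s).1 k, eval_zero_eq_jetForm hk, fun κ e z => ?_⟩
  rw [← sumOp_homField hm s κ e z, eval_zero_eq_jetForm hk]
  simp only [jet_homField]

theorem sumOp_injective (hm : 1 ≤ m) (H : Subgroup (Pt d ≃L[ℝ] Pt d)) :
    Function.Injective (sumOp hm H) := by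
  intro s s' h
  refine DFinsupp.ext fun κ => Subtype.ext (MultilinearMap.ext fun z => ?_)
  rw [← sumOp_homField_compEquiv hm s, h, sumOp_homField_compEquiv]

/-! ### Every local operator is determined by its values on jets -/

/-- A translation-equivariant local operator that vanishes at `0` on homogeneous polynomials is
zero. -/
theorem eq_zero_of_homField (hm : 1 ≤ m) {H : Subgroup (Pt d ≃L[ℝ] Pt d)} (L : linLoc H m)
    (h : ∀ (κ : {κ : ℕ →₀ ℕ // κ.degree = m}) (z : (p : Σ j : ℕ, Fin (κ.1 j)) → symJet d p.1),
      L.1 (fun i => homField (compEquiv κ i).1 (z (compEquiv κ i))) 0 = 0) : L = 0 := by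
  have h0 : ∀ f, L.1 f 0 = 0 := by
    refine eval_zero_eq_zero hm L.2.2.1 fun δ z => ?_
    obtain ⟨κ, e, he⟩ := exists_composition δ
    obtain rfl : (fun i => (e i).1) = δ := funext he
    have hz := h κ (Equiv.piCongrLeft (fun p : Σ j : ℕ, Fin (κ.1 j) => symJet d p.1) e z)
    rw [apply_homField_equiv L (compEquiv κ) e] at hz
    simpa only [Equiv.piCongrLeft_apply_apply] using hz
  refine Subtype.ext (ContinuousMultilinearMap.ext fun f => VF.ext fun x => ?_)
  -- Translation by `-x` moves the value at `x` to the origin.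
  have h1 := h0 fun i => affAct 1 (-x) (f i)
  rw [L.2.2.2 1 H.one_mem] at h1
  have h2 : affAct 1 (-x) (L.1 f) 0 = L.1 f x := by
    change L.1 f (0 - -x) = _
    rw [sub_neg_eq_add, zero_add]
  exact h2.symm.trans h1

theorem homField_jetAct (A : Pt d ≃L[ℝ] Pt d) (j : ℕ) (z : symJet d j) :
    homField j (jetAct A j z) = affAct A 0 (homField j z) := by
  refine VF.ext fun x => ?_
  change (j.factorial : ℝ)⁻¹ • A (z.1 fun _ => A.symm x) =
    A ((j.factorial : ℝ)⁻¹ • z.1 fun _ => A.symm (x - 0))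
  rw [map_smul, sub_zero]

/-- The component in `Sym_κ^H` of a local operator. -/
def component {H : Subgroup (Pt d ≃L[ℝ] Pt d)} (L : linLoc H m)
    (κ : {κ : ℕ →₀ ℕ // κ.degree = m}) : symInv κ.1 H :=
  ⟨(VF.eval 0).toLinearMap.compMultilinearMap
      ((L.1.toMultilinearMap.domDomCongr (compEquiv κ)).compLinearMap fun p => homField p.1),
    fun σ z => by
      change L.1 (fun i => homField (compEquiv κ i).1
        (z ⟨(compEquiv κ i).1, σ _ (compEquiv κ i).2⟩)) 0 = L.1 _ 0
      -- Permuting within the blocks amounts to another enumeration of the same arguments.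
      rw [apply_homField_equiv L (compEquiv κ)
        ((compEquiv κ).trans (Equiv.sigmaCongrRight σ)) z]
      rfl,
    fun A hA z => by
      change A (L.1 (fun i => homField (compEquiv κ i).1
        (jetAct A⁻¹ _ (z (compEquiv κ i)))) 0) = L.1 _ 0
      -- Linear maps fix the origin and preserve homogeneous fields, so equivariance under `A⁻¹`
      -- becomes invariance of the component.
      simp only [homField_jetAct]
      rw [L.2.2.2 A⁻¹ (H.inv_mem hA)]
      change A (A.symm (L.1 _ (A (0 - 0)))) = _
      rw [sub_zero, map_zero, A.apply_symm_apply]⟩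

theorem component_apply {H : Subgroup (Pt d ≃L[ℝ] Pt d)} (L : linLoc H m)
    (κ : {κ : ℕ →₀ ℕ // κ.degree = m}) (z : (p : Σ j : ℕ, Fin (κ.1 j)) → symJet d p.1) :
    (component L κ).1 z =
      L.1 (fun i => homField (compEquiv κ i).1 (z (compEquiv κ i))) 0 := rfl

/-- If `κ` has a part `j` above the order `k` of `L`, the corresponding homogeneous argument has
zero `k`-jet, so the component vanishes. Only finitely many compositions of size `m` live on degrees
up to `k`. -/
theorem exists_finset_component_eq_zero (hm : 1 ≤ m) {H : Subgroup (Pt d ≃L[ℝ] Pt d)}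
    (L : linLoc H m) : ∃ S : Finset {κ : ℕ →₀ ℕ // κ.degree = m},
      ∀ κ ∉ S, component L κ = 0 := by
  obtain ⟨k, hk⟩ := exists_order hm _ L.2.2.1
  refine ⟨(Finset.finsuppAntidiag (Finset.range (k + 1)) m).subtype _, fun κ hκ => ?_⟩
  have h1 : ¬ κ.1.support ⊆ Finset.range (k + 1) := fun h =>
    hκ (Finset.mem_subtype.2 (Finset.mem_finsuppAntidiag'.2 ⟨κ.2, h⟩))
  obtain ⟨j, hj, hjk⟩ := Finset.not_subset.1 h1
  have hj0 : 0 < κ.1 j := Nat.pos_of_ne_zero (Finsupp.mem_support_iff.1 hj)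
  refine Subtype.ext (MultilinearMap.ext fun z => ?_)
  rw [component_apply]
  refine hk _ ((compEquiv κ).symm ⟨j, ⟨0, hj0⟩⟩) fun n hn => ?_
  refine congrArg Subtype.val (jetPart_homField_of_ne (n := n) ?_ _)
  rw [Equiv.apply_symm_apply]
  simp only [Finset.mem_range] at hjk
  change n ≠ j
  omega

/-- The finitely many nonzero components of `L` assemble to an element `s`, and `sumOp hm H s - L`
vanishes on homogeneous fields at `0`. -/
theorem sumOp_surjective (hm : 1 ≤ m) (H : Subgroup (Pt d ≃L[ℝ] Pt d)) :
    Function.Surjective (sumOp hm H) := by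
  intro L
  obtain ⟨S, hS⟩ := exists_finset_component_eq_zero hm L
  let s : SymSum H m := DirectSum.mk _ S fun κ => component L κ
  have hs : ∀ κ, s κ = component L κ := by
    intro κ
    by_cases hκ : κ ∈ S
    · exact DirectSum.mk_apply_of_mem hκ
    · rw [hS κ hκ]
      exact DirectSum.mk_apply_of_notMem hκ
  refine ⟨s, sub_eq_zero.1 (eq_zero_of_homField hm _ fun κ z => ?_)⟩
  change (sumOp hm H s).1 _ 0 - L.1 _ 0 = 0
  rw [sumOp_homField_compEquiv, hs, component_apply, sub_self]

/-- The homogeneous polynomial as a linear function of the multilinear map. -/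
def homPolyL (d m : ℕ) :
    ContinuousMultilinearMap ℝ (fun _ : Fin m => VF d) (VF d) →ₗ[ℝ] (VF d → VF d) where
  toFun L := homPoly L
  map_add' _ _ := rfl
  map_smul' _ _ := rfl

end AffineTaylor

end

theorem mainTheorem3 (d : ℕ) (H : Subgroup (Pt d ≃L[ℝ] Pt d)) (m : ℕ) (hm : 1 ≤ m) :
    ∃ J : linLoc H m ≃ₗ[ℝ] SymSum H m,
      (∀ L : linLoc H m, IsJetRestriction L.1 (J L)) ∧
      ∃ B : SymSum H m →ₗ[ℝ] (VF d → VF d),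
        (∀ s : SymSum H m, B s = homPoly (J.symm s).1) ∧
        Function.Injective B ∧ Set.range B = taylorTerms H m := by
  let K : SymSum H m ≃ₗ[ℝ] linLoc H m :=
    LinearEquiv.ofBijective (sumOp hm H) ⟨sumOp_injective hm H, sumOp_surjective hm H⟩
  refine ⟨K.symm, fun L => ?_, homPolyL d m ∘ₗ (linLoc H m).subtype ∘ₗ K.toLinearMap,
    fun s => rfl, fun s s' h => ?_, ?_⟩
  · obtain ⟨s, rfl⟩ := K.surjective L
    rw [K.symm_apply_apply]
    exact isJetRestriction_sumOp hm s
  · exact K.injective (Subtype.ext (eq_of_homPoly_eq (K s).2.1 (K s').2.1 h))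
  · rw [taylorTerms_eq_image hm]
    ext p
    constructor
    · rintro ⟨s, rfl⟩
      exact ⟨(K s).1, (K s).2, rfl⟩
    · rintro ⟨L, hL, rfl⟩
      obtain ⟨s, hs⟩ := K.surjective ⟨L, hL⟩
      exact ⟨s, congrArg (fun L : linLoc H m => homPoly L.1) hs⟩
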